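/- All graphs are finite, undirected and simple. A connected graph $\Gamma$ of diameter $D$ is distance-regular if there are integers $b_i, c_i$ ($0\le i\le D$, $b_D=c_0=0$) such that, for all vertices $x,y$ at distance $i$, exactly $c_i$ neighbours of $y$ are at distance $i-1$ from $x$ and exactly $b_i$ neighbours of $y$ are at distance $i+1$ from $x$; put $a_1=b_0-b_1-c_1$. For a real number $b$ put $[j]=\frac{b^j-1}{b-1}$ if $b\neq 1$ and $[j]=j$ if $b=1$. A distance-regular graph $\Gamma$ of diameter $D$ has classical parameters $(D,b,\alpha,\beta)$, with $b,\alpha,\beta$ real, if $b_i=([D]-[i])(\beta-\alpha[i])$ for $0\le i\le D-1$ and $c_i=[i](1+\alpha[i-1])$ for $1\le i\le D$. For integers $c\ge 1$ and $s\ge 2$, a distance-regular graph $\Gamma$ with vertex set $V$ has the SPLS$(c,s)$ property if $a_1\ge(2s-1)(c-1)$ and, with $\mathcal L$ the set of maximal cliques of $\Gamma$ having at least $a_1+2-(c-1)(s-1)$ vertices: $V$ and $\mathcal L$ are non-empty and any two distinct vertices lie together in at most one member of $\mathcal L$ (that is, $X=(V,\mathcal L,\in)$ is a partial linear space); two distinct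 vertices are adjacent in $\Gamma$ if and only if they lie together in a member of $\mathcal L$ (that is, $\Gamma$ is the point graph of $X$); every vertex lies in at most $s$ members of $\mathcal L$; and, for every $\ell\in\mathcal L$ and every vertex $x\notin\ell$, at most $c$ vertices of $\ell$ are adjacent to $x$. The SPLS$(s)$ property is the SPLS$(c_2,s)$ property. Theorem. Let $\Gamma$ be a distance-regular graph with classical parameters $(D,b,\alpha,\beta)$ such that $b\ge 2$ and $D\ge 3$, and let $r=[D]=1+b+\cdots+b^{D-1}$. If $\beta\ge\frac13(8\alpha b+8b+5\alpha)r$, then $\Gamma$ has the SPLS$(\lfloor\frac{4r}{3}\rfloor)$ property. In particular, in this case, $\alpha$ is an integer and $0\le\alpha\le b$. -/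

import Mathlib

/-- The number `[j] = (b ^ j - 1) / (b - 1)` for `b ≠ 1`, and `[j] = j` for `b = 1`. -/
noncomputable def basicNumber (b : ℝ) (j : ℕ) : ℝ :=
  open Classical in if b = 1 then (j : ℝ) else (b ^ j - 1) / (b - 1)

/-- `G` is a distance-regular graph with intersection numbers `bNum i` and `cNum i`: for all
vertices `x`, `y` at distance `i`, exactly `cNum i` neighbours of `y` are at distance `i - 1`
from `x` and exactly `bNum i` neighbours of `y` are at distance `i + 1` from `x`.  Outside the
ranges `0 ≤ i < D` (for `bNum`) and `0 ≤ i ≤ D` (for `cNum`), where `D` is the diameter, the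
numbers are `0`, so that `bNum` and `cNum` are determined by `G`. -/
structure IsDistanceRegularWith {V : Type*} (G : SimpleGraph V) (bNum cNum : ℕ → ℕ) : Prop where
  connected : G.Connected
  ncard_closer : ∀ x y : V,
    {z : V | G.Adj y z ∧ G.dist x z + 1 = G.dist x y}.ncard = cNum (G.dist x y)
  ncard_farther : ∀ x y : V,
    {z : V | G.Adj y z ∧ G.dist x z = G.dist x y + 1}.ncard = bNum (G.dist x y)
  bNum_eq_zero : ∀ i : ℕ, G.diam ≤ i → bNum i = 0
  cNum_eq_zero : ∀ i : ℕ, G.diam < i → cNum i = 0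

/-- `G` is distance-regular with classical parameters `(D, b, α, β)`. -/
def HasClassicalParameters {V : Type*} (G : SimpleGraph V) (D : ℕ) (b α β : ℝ) : Prop :=
  ∃ bNum cNum : ℕ → ℕ, IsDistanceRegularWith G bNum cNum ∧ G.diam = D ∧
    (∀ i : ℕ, i < D →
      (bNum i : ℝ) = (basicNumber b D - basicNumber b i) * (β - α * basicNumber b i)) ∧
    (∀ i : ℕ, 1 ≤ i → i ≤ D →
      (cNum i : ℝ) = basicNumber b i * (1 + α * basicNumber b (i - 1)))

/-- An incidence relation between a type `P` of points and a type `L` of lines. -/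
structure IncidenceStructure (P L : Type*) where
  Inc : P → L → Prop

namespace IncidenceStructure

/-- Points and lines exist, and two distinct points are incident with at most one common line. -/
structure IsPartialLinearSpace {P L : Type*} (X : IncidenceStructure P L) : Prop where
  nonempty_points : Nonempty P
  nonempty_lines : Nonempty L
  line_unique : ∀ p q : P, p ≠ q → ∀ l m : L,
    X.Inc p l → X.Inc q l → X.Inc p m → X.Inc q m → l = m

/-- The point graph: distinct points are adjacent when they are on a common line. -/
def pointGraph {P L : Type*} (X : IncidenceStructure P L) : SimpleGraph P where
  Adj p q := p ≠ q ∧ ∃ l : L, X.Inc p l ∧ X.Inc q l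
  symm := ⟨fun _ _ h => ⟨h.1.symm, h.2.imp fun _ hl => ⟨hl.2, hl.1⟩⟩⟩
  loopless := ⟨fun _ h => h.1 rfl⟩

/-- The number of lines through a point. -/
noncomputable def pointOrder {P L : Type*} (X : IncidenceStructure P L) (p : P) : ℕ∞ :=
  {l : L | X.Inc p l}.encard

/-- `τ(x, ℓ)`: the number of points on the line `ℓ` that are collinear with the point `x`. -/
noncomputable def tauAt {P L : Type*} (X : IncidenceStructure P L) (x : P) (l : L) : ℕ∞ :=
  {y : P | X.Inc y l ∧ X.pointGraph.Adj x y}.encard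

/-- `τ(X)`: the maximum of `τ(x, ℓ)` over all non-incident pairs `(x, ℓ)`. -/
noncomputable def tau {P L : Type*} (X : IncidenceStructure P L) : ℕ∞ :=
  ⨆ (x : P) (l : L) (_ : ¬ X.Inc x l), X.tauAt x l

/-- The incidence structure whose lines are the members of a family of finite sets of points and
whose incidence relation is membership. -/
def ofFamily {P : Type*} (F : Set (Finset P)) : IncidenceStructure P F where
  Inc p l := p ∈ (l : Finset P)

end IncidenceStructure

/-- The maximal cliques of `G` with at least `m` vertices. -/
def largeMaximalCliques {V : Type*} (G : SimpleGraph V) (m : ℤ) : Set (Finset V) :=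
  {C : Finset V | Maximal G.IsClique (C : Set V) ∧ m ≤ (C.card : ℤ)}

/-- The incidence structure on the vertices of `G` whose lines are the maximal cliques with at
least `m` vertices. -/
def largeCliqueSpace {V : Type*} (G : SimpleGraph V) (m : ℤ) :
    IncidenceStructure V (largeMaximalCliques G m) :=
  IncidenceStructure.ofFamily (largeMaximalCliques G m)

/-- The incidence structure of maximal cliques with at least `a₁ + 2 - (c - 1) (s - 1)`
vertices. -/
abbrev splsSpace {V : Type*} (G : SimpleGraph V) (a₁ : ℤ) (c s : ℕ) :
    IncidenceStructure V
      (largeMaximalCliques G (a₁ + 2 - ((c : ℤ) - 1) * ((s : ℤ) - 1))) :=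
  largeCliqueSpace G (a₁ + 2 - ((c : ℤ) - 1) * ((s : ℤ) - 1))

/-- The conditions on the incidence structure `X` of maximal cliques with at least
`a₁ + 2 - (c - 1) (s - 1)` vertices that make up the SPLS`(c, s)` property. -/
structure IsSPLSWith {V : Type*} (G : SimpleGraph V) (a₁ : ℤ) (c s : ℕ) : Prop where
  one_le : 1 ≤ c
  two_le : 2 ≤ s
  isPartialLinearSpace : (splsSpace G a₁ c s).IsPartialLinearSpace
  pointGraph_eq : (splsSpace G a₁ c s).pointGraph = G
  le_a₁ : (2 * (s : ℤ) - 1) * ((c : ℤ) - 1) ≤ a₁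
  pointOrder_le : ∀ x : V, (splsSpace G a₁ c s).pointOrder x ≤ s
  tau_le : (splsSpace G a₁ c s).tau ≤ c

/-- The SPLS`(c, s)` property of a distance-regular graph, with `a₁ = b₀ - b₁ - c₁`. -/
def HasSPLSPair {V : Type*} (G : SimpleGraph V) (c s : ℕ) : Prop :=
  ∃ bNum cNum : ℕ → ℕ, IsDistanceRegularWith G bNum cNum ∧
    IsSPLSWith G ((bNum 0 : ℤ) - bNum 1 - cNum 1) c s

/-- The SPLS`(s)` property of a distance-regular graph: SPLS`(c, s)` with `c = c₂`. -/
def HasSPLS {V : Type*} (G : SimpleGraph V) (s : ℕ) : Prop :=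
  ∃ bNum cNum : ℕ → ℕ, IsDistanceRegularWith G bNum cNum ∧
    HasSPLSPair G (cNum 2) s

/-! Write `lam` for a₁, `m` for c₂ - 1, and s = ⌊4r/3⌋. Since m = b + α + αb, the bound on β says
exactly that (4r/3)m ≤ (β + αr)/2. Once α ≥ 0 is known, this gives lam ≥ (2s - 1)m and 2b₀ + s(s +
1)m < 2(s + 1)(lam + 1), the two conditions of a Bose–Laskar/Metsch claw argument. The second bounds
every claw by s, and the first makes large maximal cliques meet in at most one vertex. A maximum
claw at x then yields at most s large cliques through x covering its neighbourhood
(`exists_line_family`), which is the SPLS property.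

For α ≥ 0, comparing c₂, c₃ and a₂ shows that b is an integer (`exists_int_eq_base`). Negative α
would put the integer c₂ strictly between b and b + 1.

For the integrality of α and α ≤ b, the smallest eigenvalue is -r, so A + rI is positive
semidefinite. A dimension count then shows that at most |L| vertices lie on more than r lines
(`card_vertices_on_many_lines_le`). Lines are long, so |L| < |V|/2, and some two vertices at
distance 2 lie on at most r lines each. All lines through them are Delsarte cliques, which an
outside vertex meets in 0 or 1 + α neighbours. Hence α is an integer, and distributing the c₂ = (b +
1)(1 + α) common neighbours over these lines gives α ≤ b (`alpha_integer_and_le`). -/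

open Finset

/-! ### Claws and large cliques -/

section CliqueLines

variable {V : Type*} {G : SimpleGraph V}

theorem exists_not_adj_of_maximal_clique {C : Finset V} (hC : Maximal G.IsClique (C : Set V))
    {x : V} (hx : x ∉ C) : ∃ z ∈ C, ¬ G.Adj x z := by
  by_contra! h
  have h1 : G.IsClique (insert x (C : Set V)) :=
    hC.1.insert fun z hz _ => h z hz
  exact hx (hC.2 h1 (Set.subset_insert _ _) (Set.mem_insert _ _))

theorem two_le_card_of_mem_largeMaximalCliques {lam m s : ℕ}
    (hs : 1 ≤ s) (hlam : 2 * s * m ≤ lam + m) {C : Finset V}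
    (hC : C ∈ largeMaximalCliques G ((lam : ℤ) + 2 - m * ((s : ℤ) - 1))) : 2 ≤ #C := by
  have h3 := hC.2
  have h4 : (2 * s * m : ℤ) ≤ lam + m := by exact_mod_cast hlam
  have h5 : (0 : ℤ) ≤ m * ((s : ℤ) - 1) :=
    mul_nonneg (by positivity) (by have : (1 : ℤ) ≤ s := by exact_mod_cast hs
                                   linarith)
  have h6 : (m : ℤ) ≤ s * m := by exact_mod_cast Nat.le_mul_of_pos_left m hs
  have : (2 : ℤ) ≤ #C := by nlinarith
  exact_mod_cast this

/-- A set of pairwise nonadjacent neighbours of `x`. -/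
def IsClaw (G : SimpleGraph V) (x : V) (T : Finset V) : Prop :=
  (∀ y ∈ T, G.Adj x y) ∧ ∀ y ∈ T, ∀ z ∈ T, y ≠ z → ¬ G.Adj y z

theorem IsClaw.subset {x : V} {T S : Finset V} (hT : IsClaw G x T) (hS : S ⊆ T) :
    IsClaw G x S :=
  ⟨fun y hy => hT.1 y (hS hy), fun y hy z hz => hT.2 y (hS hy) z (hS hz)⟩

theorem IsClaw.insert [DecidableEq V] {x v : V} {Z : Finset V} (hZ : IsClaw G x Z)
    (hxv : G.Adj x v) (hv : ∀ z ∈ Z, ¬ G.Adj z v) : IsClaw G x (insert v Z) := by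
  constructor
  · intro z hz
    rcases mem_insert.1 hz with rfl | hz
    · exact hxv
    · exact hZ.1 z hz
  · intro z hz w hw hne hadj
    rcases mem_insert.1 hz with hz | hz <;> rcases mem_insert.1 hw with hw | hw
    · exact hne (hz.trans hw.symm)
    · exact hv w hw (hz ▸ hadj.symm)
    · exact hv z hz (hw ▸ hadj)
    · exact hZ.2 z hz w hw hne hadj

theorem exists_maximum_claw [Fintype V] (G : SimpleGraph V) (x : V) :
    ∃ T, IsClaw G x T ∧ ∀ S, IsClaw G x S → #S ≤ #T := by
  classical
  obtain ⟨T, hT, hmax⟩ := exists_max_image (univ.filter (IsClaw G x)) card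
    ⟨∅, by simp [IsClaw]⟩
  exact ⟨T, by simpa using hT, fun S hS => hmax S (by simpa using hS)⟩

variable [Fintype V] [DecidableEq V] [DecidableRel G.Adj]

/-- `G` is `k`-regular, adjacent vertices have `lam` common neighbours and distinct nonadjacent
vertices have at most `m + 1` common neighbours. -/
structure HasCommonNeighborBounds (G : SimpleGraph V) [DecidableRel G.Adj] (k lam m : ℕ) :
    Prop where
  degree_eq : ∀ x, #(G.neighborFinset x) = k
  card_common_of_adj : ∀ x y, G.Adj x y → #(G.neighborFinset x ∩ G.neighborFinset y) = lam
  card_common_of_not_adj : ∀ x y, x ≠ y → ¬ G.Adj x y →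
    #(G.neighborFinset x ∩ G.neighborFinset y) ≤ m + 1

/-- By maximality x misses some z in C, and every neighbour of x in C is a common neighbour of x and
z. -/
theorem HasCommonNeighborBounds.card_clique_inter_le {k lam m : ℕ}
    (h : HasCommonNeighborBounds G k lam m) {C : Finset V}
    (hC : Maximal G.IsClique (C : Set V)) {x : V} (hx : x ∉ C) :
    #(C ∩ G.neighborFinset x) ≤ m + 1 := by
  obtain ⟨z, hz, hxz⟩ := exists_not_adj_of_maximal_clique hC hx
  refine le_trans (card_le_card ?_) (h.card_common_of_not_adj x z (by rintro rfl; exact hx hz) hxz)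
  intro w hw
  simp only [mem_inter, SimpleGraph.mem_neighborFinset] at hw ⊢
  exact ⟨hw.2, hC.1 hz hw.1 (by rintro rfl; exact hxz hw.2)⟩

theorem HasCommonNeighborBounds.card_clique_union_le {k lam m : ℕ}
    (h : HasCommonNeighborBounds G k lam m) {C C' : Finset V}
    (hC : G.IsClique (C : Set V)) (hC' : G.IsClique (C' : Set V)) {x y : V} (hxy : x ≠ y)
    (hx : x ∈ C) (hx' : x ∈ C') (hy : y ∈ C) (hy' : y ∈ C') :
    #(C ∪ C') ≤ lam + 2 := by
  have hadj : G.Adj x y := hC hx hy hxy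
  have hsub : C ∪ C' ⊆ insert x (insert y (G.neighborFinset x ∩ G.neighborFinset y)) := by
    intro w hw
    simp only [mem_insert, mem_inter, SimpleGraph.mem_neighborFinset]
    by_cases hwx : w = x
    · exact Or.inl hwx
    by_cases hwy : w = y
    · exact Or.inr (Or.inl hwy)
    rcases mem_union.1 hw with hw | hw
    · exact Or.inr (Or.inr ⟨hC hx hw (Ne.symm hwx), hC hy hw (Ne.symm hwy)⟩)
    · exact Or.inr (Or.inr ⟨hC' hx' hw (Ne.symm hwx), hC' hy' hw (Ne.symm hwy)⟩)
  have := card_le_card hsub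
  have h1 := card_insert_le x (insert y (G.neighborFinset x ∩ G.neighborFinset y))
  have h2 := card_insert_le y (G.neighborFinset x ∩ G.neighborFinset y)
  have h3 := h.card_common_of_adj x y hadj
  omega

/-- Two cliques sharing an edge have union at most lam + 2, and distinct maximal ones have
intersection at most m + 1. So their sizes sum to at most lam + m + 3, whereas `hlam` makes the sum
at least lam + m + 4. -/
theorem HasCommonNeighborBounds.line_unique {k lam m s : ℕ}
    (h : HasCommonNeighborBounds G k lam m) (hlam : 2 * s * m ≤ lam + m)
    {C C' : Finset V}
    (hC : C ∈ largeMaximalCliques G ((lam : ℤ) + 2 - m * ((s : ℤ) - 1)))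
    (hC' : C' ∈ largeMaximalCliques G ((lam : ℤ) + 2 - m * ((s : ℤ) - 1)))
    {x y : V} (hxy : x ≠ y) (hx : x ∈ C) (hx' : x ∈ C') (hy : y ∈ C) (hy' : y ∈ C') :
    C = C' := by
  obtain ⟨hC, hcard⟩ := hC
  obtain ⟨hC', hcard'⟩ := hC'
  have hun := h.card_clique_union_le hC.1 hC'.1 hxy hx hx' hy hy'
  by_contra hne
  have hnsub : ¬ C' ⊆ C := by
    intro hsub
    exact hne (Finset.coe_injective (Set.Subset.antisymm
      (hC'.2 hC.1 (by exact_mod_cast hsub)) (by exact_mod_cast hsub)))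
  obtain ⟨z, hz', hz⟩ := Finset.not_subset.1 hnsub
  have hint : #(C ∩ C') ≤ m + 1 := by
    refine le_trans (card_le_card ?_) (h.card_clique_inter_le hC hz)
    intro w hw
    simp only [mem_inter, SimpleGraph.mem_neighborFinset] at hw ⊢
    exact ⟨hw.1, hC'.1 hz' hw.2 (by rintro rfl; exact hz hw.1)⟩
  have hsum := card_union_add_card_inter C C'
  have h1 : (#C : ℤ) + #C' ≤ lam + m + 3 := by exact_mod_cast (by omega)
  have h2 : (2 * s * m : ℤ) ≤ lam + m := by exact_mod_cast hlam
  have h3 : (m : ℤ) * ((s : ℤ) - 1) = s * m - m := by ring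
  rw [h3] at hcard hcard'
  have h4 : (2 * s * m : ℤ) = 2 * (s * m) := by ring
  rw [h4] at h2
  omega

/-- `y` together with the common neighbours of `x` and `y`. -/
def closedCommon (G : SimpleGraph V) [DecidableRel G.Adj] (x y : V) : Finset V :=
  insert y (G.neighborFinset x ∩ G.neighborFinset y)

theorem mem_closedCommon {x y w : V} :
    w ∈ closedCommon G x y ↔ w = y ∨ G.Adj x w ∧ G.Adj y w := by
  simp [closedCommon]

theorem HasCommonNeighborBounds.card_closedCommon {k lam m : ℕ}
    (h : HasCommonNeighborBounds G k lam m) {x y : V} (hxy : G.Adj x y) :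
    #(closedCommon G x y) = lam + 1 := by
  rw [closedCommon, card_insert_of_notMem, h.card_common_of_adj x y hxy]
  simp

theorem HasCommonNeighborBounds.card_closedCommon_inter_le {k lam m : ℕ}
    (h : HasCommonNeighborBounds G k lam m) {x y z : V} (hxy : G.Adj x y) (hxz : G.Adj x z)
    (hyz : y ≠ z) (hn : ¬ G.Adj y z) :
    #(closedCommon G x y ∩ closedCommon G x z) ≤ m := by
  -- The vertex x is one further common neighbour of y and z, which improves m + 1 to m.
  have hx : x ∉ closedCommon G x y ∩ closedCommon G x z := by
    simp [mem_closedCommon, hxy.ne]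
  have hsub : insert x (closedCommon G x y ∩ closedCommon G x z) ⊆
      G.neighborFinset y ∩ G.neighborFinset z := by
    intro w hw
    simp only [mem_insert, mem_inter, mem_closedCommon, SimpleGraph.mem_neighborFinset] at hw ⊢
    rcases hw with rfl | ⟨hy | hy, hz | hz⟩
    · exact ⟨hxy.symm, hxz.symm⟩
    · exact absurd (hy.symm.trans hz) hyz
    · subst hy
      exact absurd hz.2.symm hn
    · subst hz
      exact absurd hy.2 hn
    · exact ⟨hy.2, hz.2⟩
  have h1 := card_le_card hsub
  rw [card_insert_of_notMem hx] at h1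
  have := h.card_common_of_not_adj y z hyz hn
  omega

/-- Bonferroni's inequality |⋃| ≥ t(lam + 1) - t(t - 1)m/2 with t = #T, doubled and rearranged to
avoid subtraction. -/
theorem HasCommonNeighborBounds.le_card_biUnion_closedCommon {k lam m : ℕ}
    (h : HasCommonNeighborBounds G k lam m) {x : V} (T : Finset V) (hT : IsClaw G x T) :
    2 * #T * (lam + 1) + #T * m ≤ 2 * #(T.biUnion (closedCommon G x)) + #T * #T * m := by
  induction T using Finset.induction_on with
  | empty => simp
  | insert y T hy ih =>
    have ih := ih (hT.subset (subset_insert _ _))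
    rw [biUnion_insert, card_insert_of_notMem hy]
    have h1 := card_union_add_card_inter (closedCommon G x y) (T.biUnion (closedCommon G x))
    have hxy := hT.1 y (mem_insert_self _ _)
    rw [h.card_closedCommon hxy] at h1
    have h2 : #(closedCommon G x y ∩ T.biUnion (closedCommon G x)) ≤ #T * m := by
      rw [inter_biUnion]
      refine card_biUnion_le_card_mul _ _ _ fun z hz => ?_
      have hyz : y ≠ z := by rintro rfl; exact hy hz
      exact h.card_closedCommon_inter_le hxy (hT.1 z (mem_insert_of_mem hz)) hyz
        (hT.2 y (mem_insert_self _ _) z (mem_insert_of_mem hz) hyz)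
    nlinarith

/-- Apply the Bonferroni bound to s + 1 members of a larger claw: the union lies among the k
neighbours of x, against `hk`. -/
theorem HasCommonNeighborBounds.card_claw_le {k lam m s : ℕ}
    (h : HasCommonNeighborBounds G k lam m)
    (hk : 2 * k + s * (s + 1) * m < 2 * (s + 1) * (lam + 1)) {x : V} {T : Finset V}
    (hT : IsClaw G x T) : #T ≤ s := by
  by_contra! hlt
  obtain ⟨S, hST, hS⟩ := exists_subset_card_eq (show s + 1 ≤ #T from hlt)
  have hclaw := hT.subset hST
  have h1 := h.le_card_biUnion_closedCommon S hclaw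
  have h2 : #(S.biUnion (closedCommon G x)) ≤ k := by
    rw [← h.degree_eq x]
    refine card_le_card fun w hw => ?_
    obtain ⟨y, hy, hw⟩ := mem_biUnion.1 hw
    rw [SimpleGraph.mem_neighborFinset]
    rcases mem_closedCommon.1 hw with rfl | hw
    · exact hclaw.1 _ hy
    · exact hw.1
  rw [hS] at h1
  nlinarith

/-- Let W be the part of `closedCommon G x y` that avoids the sets of the other claw members. Two
nonadjacent vertices of W could replace y and enlarge the claw, so W is a clique. Each other member
removes at most m vertices, so any maximal clique containing W and x is large. -/
theorem HasCommonNeighborBounds.exists_line_of_maximum_claw {k lam m s : ℕ}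
    (h : HasCommonNeighborBounds G k lam m) {x : V} {T : Finset V} (hT : IsClaw G x T)
    (hmax : ∀ S, IsClaw G x S → #S ≤ #T) (hs : #T ≤ s) {y : V} (hy : y ∈ T) :
    ∃ C ∈ largeMaximalCliques G ((lam : ℤ) + 2 - m * ((s : ℤ) - 1)), x ∈ C ∧ y ∈ C := by
  set W := closedCommon G x y \ (T.erase y).biUnion (closedCommon G x) with hW
  have hxW : x ∉ W := by
    simp [hW, mem_closedCommon, (hT.1 y hy).ne]
  have hWx : ∀ w ∈ W, G.Adj x w := by
    intro w hw
    rcases mem_closedCommon.1 (mem_sdiff.1 hw).1 with rfl | hw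
    · exact hT.1 _ hy
    · exact hw.1
  have hWn : ∀ w ∈ W, ∀ z ∈ T.erase y, w ≠ z ∧ ¬ G.Adj w z := by
    intro w hw z hz
    have h1 := (mem_sdiff.1 hw).2
    simp only [mem_biUnion, not_exists, not_and] at h1
    have h2 := h1 z hz
    rw [mem_closedCommon, not_or, not_and] at h2
    exact ⟨h2.1, fun hadj => h2.2 (hWx w hw) hadj.symm⟩
  have hyW : y ∈ W := by
    rw [hW, mem_sdiff]
    refine ⟨mem_closedCommon.2 (Or.inl rfl), ?_⟩
    simp only [mem_biUnion, not_exists, not_and]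
    intro z hz hyz
    rcases mem_closedCommon.1 hyz with rfl | hyz
    · simp at hz
    · exact hT.2 z (mem_of_mem_erase hz) y hy (ne_of_mem_erase hz) hyz.2
  have hclique : G.IsClique (W : Set V) := by
    intro w hw w' hw' hne
    by_contra hadj
    have hw'T : w' ∉ T.erase y := fun hmem => (hWn w' hw' w' hmem).1 rfl
    have hwT : w ∉ insert w' (T.erase y) := by
      rw [mem_insert, not_or]
      exact ⟨hne, fun hmem => (hWn w hw w hmem).1 rfl⟩
    have hclaw : IsClaw G x (insert w (insert w' (T.erase y))) := by
      refine ((hT.subset (erase_subset _ _)).insert (hWx w' hw')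
        fun z hz h => (hWn w' hw' z hz).2 h.symm).insert (hWx w hw) fun z hz h => ?_
      rcases mem_insert.1 hz with rfl | hz
      · exact hadj h.symm
      · exact (hWn w hw z hz).2 h.symm
    have := hmax _ hclaw
    rw [card_insert_of_notMem hwT, card_insert_of_notMem hw'T, card_erase_of_mem hy] at this
    have := card_pos.2 ⟨y, hy⟩
    omega
  have hcliquex : G.IsClique ((insert x W : Finset V) : Set V) := by
    rw [coe_insert]
    exact hclique.insert fun w hw _ => hWx w hw
  obtain ⟨C, hsub, hC⟩ := Finite.exists_le_maximal hcliquex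
  have := Fintype.ofFinite C
  have hcardW : lam + 1 ≤ #W + (#T - 1) * m := by
    have h1 := card_sdiff_add_card_inter (closedCommon G x y)
      ((T.erase y).biUnion (closedCommon G x))
    rw [h.card_closedCommon (hT.1 y hy), ← hW, inter_biUnion] at h1
    have h2 : #((T.erase y).biUnion fun z => closedCommon G x y ∩ closedCommon G x z) ≤
        #(T.erase y) * m := by
      refine card_biUnion_le_card_mul _ _ _ fun z hz => ?_
      have hyz := (ne_of_mem_erase hz).symm
      exact h.card_closedCommon_inter_le (hT.1 y hy) (hT.1 z (mem_of_mem_erase hz)) hyz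
        (hT.2 y hy z (mem_of_mem_erase hz) hyz)
    rw [card_erase_of_mem hy] at h2
    omega
  refine ⟨C.toFinset, ⟨by simpa using hC, ?_⟩, ?_, ?_⟩
  · have h1 : insert x W ⊆ C.toFinset := by
      intro w hw
      rw [Set.mem_toFinset]
      exact hsub (by exact_mod_cast hw)
    have h2 := card_le_card h1
    rw [card_insert_of_notMem hxW] at h2
    have hpos := card_pos.2 ⟨y, hy⟩
    have h3 : (#T - 1) * m ≤ (s - 1) * m := Nat.mul_le_mul_right _ (by omega)
    have h4 : lam + 2 ≤ #C.toFinset + (s - 1) * m := by omega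
    zify [show 1 ≤ s by omega] at h4
    linarith
  · rw [Set.mem_toFinset]
    exact hsub (by simp)
  · rw [Set.mem_toFinset]
    exact hsub (by simp [hyW])

theorem HasCommonNeighborBounds.exists_line_family {k lam m s : ℕ}
    (h : HasCommonNeighborBounds G k lam m) (hlam : 2 * s * m ≤ lam + m)
    (hk : 2 * k + s * (s + 1) * m < 2 * (s + 1) * (lam + 1)) (x : V) :
    ∃ (T : Finset V) (ℓ : V → Finset V), #T ≤ s ∧
      (∀ y ∈ T, ℓ y ∈ largeMaximalCliques G ((lam : ℤ) + 2 - m * ((s : ℤ) - 1)) ∧ x ∈ ℓ y) ∧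
      ∀ w, G.Adj x w → ∃ y ∈ T, w ∈ ℓ y := by
  obtain ⟨T, hT, hmax⟩ := exists_maximum_claw G x
  have hs := h.card_claw_le hk hT
  choose! ℓ hℓ hxℓ hyℓ using fun y (hy : y ∈ T) => h.exists_line_of_maximum_claw hT hmax hs hy
  refine ⟨T, ℓ, hs, fun y hy => ⟨hℓ y hy, hxℓ y hy⟩, fun w hw => ?_⟩
  by_contra! hnot
  -- An uncovered neighbour w starts a claw that gains one vertex from each line ℓ j, and so ends up
  -- larger than T.
  have key : ∀ S ⊆ T, ∃ Z, IsClaw G x Z ∧ #Z = #S + 1 ∧ ∀ z ∈ Z, z = w ∨ ∃ y ∈ S, z ∈ ℓ y := by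
    intro S
    induction S using Finset.induction_on with
    | empty =>
      intro _
      refine ⟨{w}, ⟨by simpa using hw, ?_⟩, by simp, by simp⟩
      intro y hy z hz hne
      simp only [mem_singleton] at hy hz
      exact absurd (hy.trans hz.symm) hne
    | insert j S hj ih =>
      intro hsub
      obtain ⟨Z, hZ, hcard, hmem⟩ := ih ((subset_insert _ _).trans hsub)
      have hjT : j ∈ T := hsub (mem_insert_self _ _)
      have hZℓ : ∀ z ∈ Z, z ∉ ℓ j := by
        intro z hz hzj
        rcases hmem z hz with rfl | ⟨i, hi, hzi⟩
        · exact hnot j hjT hzj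
        · have hiT : i ∈ T := hsub (mem_insert_of_mem hi)
          have hij : i ≠ j := by rintro rfl; exact hj hi
          have heq := h.line_unique hlam (hℓ i hiT) (hℓ j hjT) (hZ.1 z hz).ne
            (hxℓ i hiT) (hxℓ j hjT) hzi hzj
          exact hT.2 i hiT j hjT hij ((hℓ j hjT).1.1 (heq ▸ hyℓ i hiT) (hyℓ j hjT) hij)
      -- Each z lies off ℓ j and has at most m + 1 neighbours there, one of them x. So at most sm
      -- vertices of ℓ j other than x are forbidden, while ℓ j has at least sm + 2 vertices.
      have hbad : #(Z.biUnion fun z => (ℓ j).erase x ∩ G.neighborFinset z) ≤ #Z * m := by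
        refine card_biUnion_le_card_mul _ _ _ fun z hz => ?_
        have h1 := h.card_clique_inter_le (hℓ j hjT).1 (hZℓ z hz)
        have h2 : x ∈ ℓ j ∩ G.neighborFinset z := by
          simp [hxℓ j hjT, (hZ.1 z hz).symm]
        rw [erase_inter, card_erase_of_mem h2]
        omega
      have hlt : #(Z.biUnion fun z => (ℓ j).erase x ∩ G.neighborFinset z) < #((ℓ j).erase x) := by
        refine lt_of_le_of_lt hbad ?_
        have h1 : #(insert j S) ≤ s := (card_le_card hsub).trans hs
        rw [card_insert_of_notMem hj, ← hcard] at h1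
        have h2 : #Z * m ≤ s * m := Nat.mul_le_mul_right _ h1
        rw [card_erase_of_mem (hxℓ j hjT)]
        have h3 := (hℓ j hjT).2
        have h4 : (2 * s * m : ℤ) ≤ lam + m := by exact_mod_cast hlam
        have h5 : (m : ℤ) * ((s : ℤ) - 1) = s * m - m := by ring
        have h6 : (2 * s * m : ℤ) = 2 * (s * m) := by ring
        rw [h5] at h3
        rw [h6] at h4
        have h7 : ((#Z * m : ℕ) : ℤ) ≤ (s : ℤ) * m := by exact_mod_cast h2
        have h8 : ((#Z * m : ℕ) : ℤ) + 2 ≤ #(ℓ j) := by linarith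
        omega
      obtain ⟨v, hv, hvn⟩ := exists_mem_notMem_of_card_lt_card hlt
      have hvx : G.Adj x v :=
        (hℓ j hjT).1.1 (hxℓ j hjT) (mem_of_mem_erase hv) (ne_of_mem_erase hv).symm
      have hvZ : ∀ z ∈ Z, ¬ G.Adj z v := by
        intro z hz hadj
        exact hvn (mem_biUnion.2 ⟨z, hz, mem_inter.2 ⟨hv, by simpa using hadj⟩⟩)
      have hvZ' : v ∉ Z := fun hmem => hZℓ v hmem (mem_of_mem_erase hv)
      refine ⟨insert v Z, hZ.insert hvx hvZ, ?_, ?_⟩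
      · rw [card_insert_of_notMem hvZ', card_insert_of_notMem hj, hcard]
      · intro z hz
        rcases mem_insert.1 hz with rfl | hz
        · exact Or.inr ⟨j, mem_insert_self _ _, mem_of_mem_erase hv⟩
        · rcases hmem z hz with h | ⟨i, hi, hzi⟩
          · exact Or.inl h
          · exact Or.inr ⟨i, mem_insert_of_mem hi, hzi⟩
  obtain ⟨Z, hZ, hcard, -⟩ := key T Subset.rfl
  have := hmax Z hZ
  omega

theorem HasCommonNeighborBounds.exists_line_of_adj {k lam m s : ℕ}
    (h : HasCommonNeighborBounds G k lam m) (hlam : 2 * s * m ≤ lam + m)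
    (hk : 2 * k + s * (s + 1) * m < 2 * (s + 1) * (lam + 1)) {x y : V} (hxy : G.Adj x y) :
    ∃ C ∈ largeMaximalCliques G ((lam : ℤ) + 2 - m * ((s : ℤ) - 1)), x ∈ C ∧ y ∈ C := by
  obtain ⟨T, ℓ, -, hℓ, hcov⟩ := h.exists_line_family hlam hk x
  obtain ⟨i, hi, hy⟩ := hcov y hxy
  exact ⟨ℓ i, (hℓ i hi).1, (hℓ i hi).2, hy⟩

theorem HasCommonNeighborBounds.card_lines_le {k lam m s : ℕ}
    (h : HasCommonNeighborBounds G k lam m) (hs : 1 ≤ s) (hlam : 2 * s * m ≤ lam + m)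
    (hk : 2 * k + s * (s + 1) * m < 2 * (s + 1) * (lam + 1)) (x : V) :
    {C | C ∈ largeMaximalCliques G ((lam : ℤ) + 2 - m * ((s : ℤ) - 1)) ∧ x ∈ C}.ncard ≤ s := by
  obtain ⟨T, ℓ, hTs, hℓ, hcov⟩ := h.exists_line_family hlam hk x
  have hsub : {C | C ∈ largeMaximalCliques G ((lam : ℤ) + 2 - m * ((s : ℤ) - 1)) ∧ x ∈ C} ⊆
      (T.image ℓ : Finset (Finset V)) := by
    rintro C ⟨hC, hx⟩
    obtain ⟨y, hy, hne⟩ := exists_mem_ne (two_le_card_of_mem_largeMaximalCliques hs hlam hC) x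
    obtain ⟨i, hi, hyi⟩ := hcov y (hC.1.1 hx hy hne.symm)
    have := h.line_unique hlam hC (hℓ i hi).1 hne.symm hx (hℓ i hi).2 hy hyi
    simp only [coe_image, Set.mem_image, mem_coe]
    exact ⟨i, hi, this.symm⟩
  refine (Set.ncard_le_ncard hsub (Finset.finite_toSet _)).trans ?_
  rw [Set.ncard_coe_finset]
  exact card_image_le.trans hTs

end CliqueLines

/-! ### Distances and intersection numbers -/

section Distances

variable {V : Type*} {G : SimpleGraph V}

theorem SimpleGraph.Connected.exists_adj_dist_eq (hG : G.Connected) {x y : V} {i : ℕ}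
    (h : G.dist x y = i + 1) : ∃ z, G.Adj y z ∧ G.dist x z = i := by
  obtain ⟨p, hp⟩ := hG.exists_walk_length_eq_dist y x
  rw [SimpleGraph.dist_comm, h] at hp
  cases p with
  | nil => simp at hp
  | @cons _ z _ hadj q =>
    refine ⟨z, hadj, le_antisymm ?_ ?_⟩
    · rw [SimpleGraph.dist_comm]
      refine (SimpleGraph.dist_le q).trans ?_
      simp only [SimpleGraph.Walk.length_cons] at hp
      omega
    · have h1 := hG.dist_triangle (u := x) (v := z) (w := y)
      rw [h, SimpleGraph.dist_eq_one_iff_adj.2 hadj.symm] at h1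
      omega

theorem SimpleGraph.Connected.exists_dist_eq [Finite V] (hG : G.Connected) {i : ℕ}
    (hi : i ≤ G.diam) : ∃ x y, G.dist x y = i := by
  have := hG.nonempty
  obtain ⟨x, y, hxy⟩ := G.exists_dist_eq_diam
  have key : ∀ j ≤ G.diam, ∃ z, G.dist x z = G.diam - j := by
    intro j
    induction j with
    | zero => exact fun _ => ⟨y, by simpa using hxy⟩
    | succ j ih =>
      intro hj
      obtain ⟨z, hz⟩ := ih (by omega)
      obtain ⟨w, -, hw⟩ := hG.exists_adj_dist_eq (i := G.diam - (j + 1)) (hz.trans (by omega))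
      exact ⟨w, hw⟩
  obtain ⟨z, hz⟩ := key (G.diam - i) (Nat.sub_le _ _)
  exact ⟨x, z, by omega⟩

theorem SimpleGraph.Connected.dist_le_diam [Finite V] (hG : G.Connected) (x y : V) :
    G.dist x y ≤ G.diam := by
  have := hG.nonempty
  exact SimpleGraph.dist_le_diam (SimpleGraph.connected_iff_ediam_ne_top.1 hG)

end Distances

/-- The action of the tridiagonal intersection matrix on sequences. -/
noncomputable def triOp (bNum cNum : ℕ → ℕ) (f : ℕ → ℝ) (i : ℕ) : ℝ :=
  cNum i * f (i - 1) + ((bNum 0 : ℝ) - bNum i - cNum i) * f i + bNum i * f (i + 1)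

namespace IsDistanceRegularWith

variable {V : Type*} [Fintype V] {G : SimpleGraph V} [DecidableRel G.Adj]
  {bNum cNum : ℕ → ℕ}

theorem card_closer (h : IsDistanceRegularWith G bNum cNum) (x y : V) :
    #{z ∈ G.neighborFinset y | G.dist x z + 1 = G.dist x y} = cNum (G.dist x y) := by
  rw [← h.ncard_closer x y, ← Set.ncard_coe_finset]
  congr 1
  ext z
  simp

theorem card_farther (h : IsDistanceRegularWith G bNum cNum) (x y : V) :
    #{z ∈ G.neighborFinset y | G.dist x z = G.dist x y + 1} = bNum (G.dist x y) := by
  rw [← h.ncard_farther x y, ← Set.ncard_coe_finset]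
  congr 1
  ext z
  simp

theorem card_neighborFinset (h : IsDistanceRegularWith G bNum cNum) (x : V) :
    #(G.neighborFinset x) = bNum 0 := by
  have h1 := h.card_farther x x
  rw [SimpleGraph.dist_self, filter_true_of_mem] at h1
  · exact h1
  · intro z hz
    simpa using hz

theorem cNum_zero (h : IsDistanceRegularWith G bNum cNum) : cNum 0 = 0 := by
  obtain ⟨x⟩ := h.connected.nonempty
  have h1 := h.card_closer x x
  rw [SimpleGraph.dist_self, filter_false_of_mem] at h1
  · simpa using h1.symm
  · intro z _
    omega

theorem cNum_pos (h : IsDistanceRegularWith G bNum cNum) {i : ℕ} (hi : 1 ≤ i)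
    (hi' : i ≤ G.diam) : 0 < cNum i := by
  obtain ⟨x, y, hxy⟩ := h.connected.exists_dist_eq hi'
  obtain ⟨z, hyz, hz⟩ := h.connected.exists_adj_dist_eq (i := i - 1) (hxy.trans (by omega))
  rw [← hxy, ← h.card_closer x y]
  exact card_pos.2 ⟨z, by simp [hyz]; omega⟩

theorem bNum_pos (h : IsDistanceRegularWith G bNum cNum) {i : ℕ} (hi : i < G.diam) :
    0 < bNum i := by
  obtain ⟨x, y, hxy⟩ := h.connected.exists_dist_eq (i := i + 1) hi
  obtain ⟨z, hyz, hz⟩ := h.connected.exists_adj_dist_eq hxy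
  rw [← hz, ← h.card_farther x z]
  exact card_pos.2 ⟨y, by simp [hyz.symm]; omega⟩

/-- The adjacency operator preserves functions of the distance from x and acts on them through the
intersection matrix. -/
theorem sum_neighborFinset_dist (h : IsDistanceRegularWith G bNum cNum) (f : ℕ → ℝ) (x y : V) :
    ∑ z ∈ G.neighborFinset y, f (G.dist x z) = triOp bNum cNum f (G.dist x y) := by
  set i := G.dist x y with hi
  have key : ∀ z ∈ G.neighborFinset y, f (G.dist x z) =
      f i + (if G.dist x z + 1 = i then f (i - 1) - f i else 0)
        + (if G.dist x z = i + 1 then f (i + 1) - f i else 0) := by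
    intro z hz
    rw [SimpleGraph.mem_neighborFinset] at hz
    rcases hz.diff_dist_adj (u := x) with h1 | h1 | h1
    · rw [h1, ← hi]
      simp
    · rw [h1, ← hi]
      simp [show ¬ (i + 1 + 1 = i) by omega]
    · by_cases h0 : i = 0
      · rw [h1, ← hi, h0]
        simp
      · rw [h1, ← hi]
        simp [show i - 1 + 1 = i by omega, show ¬ (i - 1 = i + 1) by omega]
  rw [sum_congr rfl key, sum_add_distrib, sum_add_distrib, sum_const, ← sum_filter, ← sum_filter,
    sum_const, sum_const, h.card_closer, h.card_farther, h.card_neighborFinset, triOp]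
  simp only [nsmul_eq_mul, ← hi]
  ring

variable [DecidableEq V]

theorem card_common_neighbors (h : IsDistanceRegularWith G bNum cNum) {x y : V}
    (hxy : G.Adj x y) :
    #(G.neighborFinset x ∩ G.neighborFinset y) + bNum 1 + cNum 1 = bNum 0 := by
  have h1 := h.sum_neighborFinset_dist (fun i => if i = 1 then 1 else 0) x y
  rw [SimpleGraph.dist_eq_one_iff_adj.2 hxy, ← sum_filter, sum_const] at h1
  have h2 : {z ∈ G.neighborFinset y | G.dist x z = 1} =
      G.neighborFinset x ∩ G.neighborFinset y := by
    ext z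
    simp [and_comm]
  rw [h2] at h1
  simp only [triOp] at h1
  norm_num at h1
  have h3 : ((#(G.neighborFinset x ∩ G.neighborFinset y) + bNum 1 + cNum 1 : ℕ) : ℝ) =
      (bNum 0 : ℕ) := by
    push_cast
    linarith
  exact_mod_cast h3

theorem card_common_of_dist_eq_two (h : IsDistanceRegularWith G bNum cNum) {x y : V}
    (hxy : G.dist x y = 2) :
    #(G.neighborFinset x ∩ G.neighborFinset y) = cNum 2 := by
  rw [← hxy, ← h.card_closer x y]
  congr 1
  ext z
  simp [hxy, and_comm]

theorem card_common_of_not_adj (h : IsDistanceRegularWith G bNum cNum) {x y : V}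
    (hne : x ≠ y) (hxy : ¬ G.Adj x y) :
    #(G.neighborFinset x ∩ G.neighborFinset y) ≤ cNum 2 := by
  rcases (G.neighborFinset x ∩ G.neighborFinset y).eq_empty_or_nonempty with h0 | ⟨z, hz⟩
  · simp [h0]
  · refine (h.card_common_of_dist_eq_two ?_).le
    simp only [mem_inter, SimpleGraph.mem_neighborFinset] at hz
    have h1 := h.connected.dist_triangle (u := x) (v := z) (w := y)
    rw [SimpleGraph.dist_eq_one_iff_adj.2 hz.1, SimpleGraph.dist_eq_one_iff_adj.2 hz.2.symm] at h1
    have h2 : G.dist x y ≠ 0 := by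
      rw [Ne, h.connected.dist_eq_zero_iff]
      exact hne
    have h3 : G.dist x y ≠ 1 := by rwa [Ne, SimpleGraph.dist_eq_one_iff_adj]
    omega

end IsDistanceRegularWith

/-! ### Eigenfunctions, Gram identities and the smallest eigenvalue -/

section Eigenfunctions

variable {V : Type*} [Fintype V] {G : SimpleGraph V}

/-- `f` satisfies the eigenvalue equation of the adjacency matrix for `θ`. -/
def IsEigenfunction (G : SimpleGraph V) [DecidableRel G.Adj] (θ : ℝ) (f : V → ℝ) : Prop :=
  ∀ y, ∑ z ∈ G.neighborFinset y, f z = θ * f y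

/-- The sum of `f` over the sphere of radius `i` about `x`. -/
noncomputable def sphereSum (G : SimpleGraph V) (f : V → ℝ) (x : V) (i : ℕ) : ℝ :=
  ∑ y with G.dist x y = i, f y

theorem sum_mul_eq_sum_sphereSum (hG : G.Connected) (g : ℕ → ℝ) (f : V → ℝ) (x : V) :
    ∑ y, g (G.dist x y) * f y = ∑ i ∈ range (G.diam + 1), g i * sphereSum G f x i := by
  rw [← sum_fiberwise_of_maps_to (t := range (G.diam + 1)) (g := fun y => G.dist x y)
    (fun y _ => mem_range.2 (Nat.lt_succ_of_le (hG.dist_le_diam x y)))]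
  refine sum_congr rfl fun i _ => ?_
  rw [sphereSum, mul_sum]
  refine sum_congr rfl fun y hy => ?_
  rw [(mem_filter.1 hy).2]

theorem sphereSum_eq_sum_ite (f : V → ℝ) (x : V) (i : ℕ) :
    sphereSum G f x i = ∑ y, (if G.dist x y = i then 1 else 0) * f y := by
  simp [sphereSum, sum_filter]

namespace IsDistanceRegularWith

variable [DecidableRel G.Adj] {bNum cNum : ℕ → ℕ}

/-- Self-adjointness of the adjacency operator, applied to an eigenfunction and a radial function.
-/
theorem sum_dist_mul_eigenfunction (h : IsDistanceRegularWith G bNum cNum) {θ : ℝ} {f : V → ℝ}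
    (hf : IsEigenfunction G θ f) (g : ℕ → ℝ) (x : V) :
    θ * ∑ y, g (G.dist x y) * f y = ∑ y, triOp bNum cNum g (G.dist x y) * f y := by
  calc θ * ∑ y, g (G.dist x y) * f y
      = ∑ y, ∑ z ∈ G.neighborFinset y, g (G.dist x y) * f z := by
        rw [mul_sum]
        refine sum_congr rfl fun y _ => ?_
        rw [← mul_sum, hf y]
        ring
    _ = ∑ z, ∑ y ∈ G.neighborFinset z, g (G.dist x y) * f z :=
        sum_comm' (by simp [SimpleGraph.adj_comm])
    _ = _ := by
        refine sum_congr rfl fun z _ => ?_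
        rw [← sum_mul, h.sum_neighborFinset_dist]

theorem triOp_indicator (h : IsDistanceRegularWith G bNum cNum) (i j : ℕ) :
    triOp bNum cNum (fun l => if l = i then 1 else 0) j =
      cNum (i + 1) * (if j = i + 1 then 1 else 0)
      + ((bNum 0 : ℝ) - bNum i - cNum i) * (if j = i then 1 else 0)
      + (if j + 1 = i then (bNum j : ℝ) else 0) := by
  unfold triOp
  have h0 : (cNum 0 : ℝ) = 0 := by exact_mod_cast h.cNum_zero
  by_cases h1 : j = i + 1
  · subst h1
    simp
  by_cases h2 : j = i
  · subst h2
    by_cases h3 : j = 0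
    · subst h3
      simp [h0]
    · simp [show ¬ (j - 1 = j) by omega]
  · by_cases h3 : j = 0
    · subst h3
      simp [h0, h2]
    · simp [h1, h2, show ¬ (j - 1 = i) by omega]

theorem sphereSum_succ (h : IsDistanceRegularWith G bNum cNum) {θ : ℝ} {f : V → ℝ}
    (hf : IsEigenfunction G θ f) (x : V) (i : ℕ) :
    (cNum (i + 1) : ℝ) * sphereSum G f x (i + 1) =
      (θ - ((bNum 0 : ℝ) - bNum i - cNum i)) * sphereSum G f x i
      - ∑ y, (if G.dist x y + 1 = i then (bNum (G.dist x y) : ℝ) else 0) * f y := by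
  have h1 := h.sum_dist_mul_eigenfunction hf (fun l => if l = i then 1 else 0) x
  simp only [h.triOp_indicator, add_mul, sum_add_distrib, mul_assoc, ← mul_sum] at h1
  rw [← sphereSum_eq_sum_ite, ← sphereSum_eq_sum_ite] at h1
  linarith

/-- Sphere sums satisfy a three-term recurrence that c_{i+1} ≠ 0 lets one solve, so the factor
depends only on θ and i. Spheres beyond the diameter are empty. -/
theorem exists_sphereSum_eq (h : IsDistanceRegularWith G bNum cNum) (θ : ℝ) (i : ℕ) :
    ∃ l : ℝ, ∀ f, IsEigenfunction G θ f → ∀ x, sphereSum G f x i = l * f x := by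
  have hbig : ∀ i, G.diam < i → ∃ l : ℝ, ∀ f, IsEigenfunction G θ f →
      ∀ x, sphereSum G f x i = l * f x := by
    intro i hi
    refine ⟨0, fun f _ x => ?_⟩
    rw [sphereSum, filter_false_of_mem, sum_empty, zero_mul]
    intro y _ hy
    have := h.connected.dist_le_diam x y
    omega
  induction i using Nat.strong_induction_on with
  | _ i ih =>
    rcases i with _ | i
    · refine ⟨1, fun f _ x => ?_⟩
      have : ({y | G.dist x y = 0} : Finset V) = {x} := by
        ext y
        simp [h.connected.dist_eq_zero_iff, eq_comm]
      rw [sphereSum, this, sum_singleton, one_mul]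
    · by_cases hi : i + 1 ≤ G.diam
      swap
      · exact hbig _ (by omega)
      have hc : (cNum (i + 1) : ℝ) ≠ 0 := by
        exact_mod_cast (h.cNum_pos (by omega) hi).ne'
      obtain ⟨l, hl⟩ := ih i (by omega)
      rcases i with _ | i
      · refine ⟨(θ - ((bNum 0 : ℝ) - bNum 0 - cNum 0)) * l / cNum (0 + 1), fun f hf x => ?_⟩
        have h1 := h.sphereSum_succ hf x 0
        rw [hl f hf x] at h1
        simp only [Nat.succ_ne_zero, if_false, zero_mul, sum_const_zero, sub_zero] at h1
        rw [div_mul_eq_mul_div, eq_div_iff hc, mul_comm, h1]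
        ring
      · obtain ⟨l', hl'⟩ := ih i (by omega)
        refine ⟨((θ - ((bNum 0 : ℝ) - bNum (i + 1) - cNum (i + 1))) * l - bNum i * l')
          / cNum (i + 1 + 1), fun f hf x => ?_⟩
        have h1 := h.sphereSum_succ hf x (i + 1)
        have h2 : ∑ y, (if G.dist x y + 1 = i + 1 then (bNum (G.dist x y) : ℝ) else 0) * f y =
            bNum i * sphereSum G f x i := by
          rw [sphereSum_eq_sum_ite, mul_sum]
          refine sum_congr rfl fun y _ => ?_
          by_cases hy : G.dist x y = i <;> simp [hy]
        rw [hl f hf x, h2, hl' f hf x] at h1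
        rw [div_mul_eq_mul_div, eq_div_iff hc, mul_comm, h1]
        ring

/-- A sequence that satisfies the three-term recurrence gives a scalar multiple of an
idempotent: it reproduces eigenfunctions up to a constant. -/
theorem exists_sum_dist_mul_eq (h : IsDistanceRegularWith G bNum cNum) (θ : ℝ) (g : ℕ → ℝ) :
    ∃ l : ℝ, ∀ f, IsEigenfunction G θ f → ∀ x, ∑ y, g (G.dist x y) * f y = l * f x := by
  choose l hl using h.exists_sphereSum_eq θ
  refine ⟨∑ i ∈ range (G.diam + 1), g i * l i, fun f hf x => ?_⟩
  rw [sum_mul_eq_sum_sphereSum h.connected, sum_mul]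
  refine sum_congr rfl fun i _ => ?_
  rw [hl i f hf x]
  ring

theorem isEigenfunction_dist (h : IsDistanceRegularWith G bNum cNum) {θ : ℝ} {u : ℕ → ℝ}
    (hu : ∀ i ≤ G.diam, triOp bNum cNum u i = θ * u i) (x : V) :
    IsEigenfunction G θ fun y => u (G.dist x y) := fun y => by
  rw [h.sum_neighborFinset_dist, hu _ (h.connected.dist_le_diam x y)]

/-- The columns of the matrix with entries u(dist) are eigenfunctions, so its square is a multiple
of itself. The diagonal shows that the factor is positive. -/
theorem exists_gram (h : IsDistanceRegularWith G bNum cNum) {θ : ℝ} {u : ℕ → ℝ}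
    (hu : ∀ i ≤ G.diam, triOp bNum cNum u i = θ * u i) (hu0 : u 0 = 1) :
    ∃ l : ℝ, 0 < l ∧
      ∀ y w, ∑ x, u (G.dist x y) * u (G.dist x w) = l * u (G.dist y w) := by
  obtain ⟨l, hl⟩ := h.exists_sum_dist_mul_eq θ u
  have key : ∀ y w, ∑ x, u (G.dist x y) * u (G.dist x w) = l * u (G.dist y w) := by
    intro y w
    have := hl _ (h.isEigenfunction_dist hu w) y
    rw [SimpleGraph.dist_comm (u := w)] at this
    rw [← this]
    refine sum_congr rfl fun x _ => ?_
    rw [SimpleGraph.dist_comm (u := y), SimpleGraph.dist_comm (u := w)]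
  refine ⟨l, ?_, key⟩
  obtain ⟨x⟩ := h.connected.nonempty
  have h1 := key x x
  rw [SimpleGraph.dist_self, hu0, mul_one] at h1
  rw [← h1]
  refine sum_pos' (fun z _ => mul_self_nonneg _) ⟨x, mem_univ _, ?_⟩
  simp [hu0]

theorem exists_clique_gram (h : IsDistanceRegularWith G bNum cNum) {θ : ℝ} {u : ℕ → ℝ}
    (hu : ∀ i ≤ G.diam, triOp bNum cNum u i = θ * u i) (hu0 : u 0 = 1) :
    ∃ l : ℝ, 0 < l ∧ ∀ C : Finset V, G.IsClique (C : Set V) →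
      ∑ x, (∑ y ∈ C, u (G.dist x y)) ^ 2 = l * (#C * (1 + ((#C : ℝ) - 1) * u 1)) := by
  obtain ⟨l, hl, hg⟩ := h.exists_gram hu hu0
  classical
  refine ⟨l, hl, fun C hC => ?_⟩
  have hrow : ∀ y ∈ C, ∑ w ∈ C, u (G.dist y w) = 1 + ((#C : ℝ) - 1) * u 1 := by
    intro y hy
    rw [← add_sum_erase _ _ hy, SimpleGraph.dist_self, hu0,
      sum_congr rfl (g := fun _ => u 1), sum_const, nsmul_eq_mul, card_erase_of_mem hy,
      Nat.cast_sub (card_pos.2 ⟨y, hy⟩), Nat.cast_one]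
    intro w hw
    rw [SimpleGraph.dist_eq_one_iff_adj.2
      (hC hy (mem_of_mem_erase hw) (ne_of_mem_erase hw).symm)]
  calc ∑ x, (∑ y ∈ C, u (G.dist x y)) ^ 2
      = ∑ x, ∑ y ∈ C, ∑ w ∈ C, u (G.dist x y) * u (G.dist x w) := by
        refine sum_congr rfl fun x _ => ?_
        rw [sq, sum_mul_sum]
    _ = ∑ y ∈ C, ∑ w ∈ C, ∑ x, u (G.dist x y) * u (G.dist x w) := by
        rw [sum_comm]
        refine sum_congr rfl fun y _ => ?_
        rw [sum_comm]
    _ = ∑ y ∈ C, l * (1 + ((#C : ℝ) - 1) * u 1) := by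
        refine sum_congr rfl fun y hy => ?_
        simp only [hg, ← mul_sum]
        rw [hrow y hy]
    _ = _ := by
        rw [sum_const, nsmul_eq_mul]
        ring

/-- An eigenvalue whose standard sequence alternates in sign is the smallest one. -/
theorem le_of_isEigenfunction (h : IsDistanceRegularWith G bNum cNum) {θ : ℝ} {u : ℕ → ℝ}
    (hu : ∀ i ≤ G.diam, triOp bNum cNum u i = θ * u i) (hu0 : u 0 = 1)
    (hsign : ∀ i, 0 ≤ (-1) ^ i * u i) {μ : ℝ} {f : V → ℝ} (hf : IsEigenfunction G μ f)
    (hf0 : f ≠ 0) : θ ≤ μ := by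
  obtain ⟨x, hx⟩ := Function.ne_iff.1 hf0
  have habs : ∀ i, |u i| = (-1) ^ i * u i := by
    intro i
    rw [← abs_of_nonneg (hsign i), abs_mul, abs_pow, abs_neg, abs_one, one_pow, one_mul]
  set H := sphereSum G f x with hH
  have hH0 : H 0 = f x := by
    have : ({y | G.dist x y = 0} : Finset V) = {x} := by
      ext y
      simp [h.connected.dist_eq_zero_iff, eq_comm]
    rw [hH, sphereSum, this, sum_singleton]
  have hs : ∀ i, |(SignType.sign (H i) : ℝ)| ≤ 1 := by
    intro i
    rcases lt_trichotomy (H i) 0 with h | h | h <;> simp [h]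
  -- The test sequence has the moduli of u and the signs of the sphere sums H. Diagonal terms of the
  -- pairing are then exact, and off-diagonal terms are at least -|u||H|.
  set g : ℕ → ℝ := fun i => SignType.sign (H i) * |u i| with hgdef
  have hg : ∀ i, g i * H i = |u i| * |H i| := by
    intro i
    have : (SignType.sign (H i) : ℝ) * H i = |H i| := by rw [sign_mul_self]
    simp only [hgdef]
    rw [mul_right_comm, this, mul_comm]
  have hgle : ∀ i, |g i| ≤ |u i| := by
    intro i
    simp only [hgdef]
    rw [abs_mul, abs_abs]
    exact mul_le_of_le_one_left (abs_nonneg _) (hs i)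
  have hkey := h.sum_dist_mul_eigenfunction hf g x
  rw [sum_mul_eq_sum_sphereSum h.connected, sum_mul_eq_sum_sphereSum h.connected] at hkey
  have hterm : ∀ i ∈ range (G.diam + 1), θ * (g i * H i) ≤ triOp bNum cNum g i * H i := by
    intro i hi
    have hi' : i ≤ G.diam := by simpa [Nat.lt_succ_iff] using hi
    -- Alternation turns the recurrence for u into one for |u| with the off-diagonal signs reversed.
    have hui : (cNum i : ℝ) * -|u (i - 1)| + ((bNum 0 : ℝ) - bNum i - cNum i) * |u i|
        + bNum i * -|u (i + 1)| = θ * |u i| := by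
      have h1 := hu i hi'
      unfold triOp at h1
      simp only [habs]
      rcases i with _ | i
      · have h0 : (cNum 0 : ℝ) = 0 := by exact_mod_cast h.cNum_zero
        rw [h0] at h1 ⊢
        simp only [pow_zero, zero_add, pow_one]
        linarith
      · simp only [Nat.add_sub_cancel, pow_succ] at h1 ⊢
        linear_combination (-1) ^ (i + 1) * h1
    have hb : ∀ j, -|u j| * |H i| ≤ g j * H i := by
      intro j
      have h1 : |g j * H i| ≤ |u j| * |H i| := by
        rw [abs_mul]
        exact mul_le_mul_of_nonneg_right (hgle j) (abs_nonneg _)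
      have h2 := neg_abs_le (g j * H i)
      linarith
    calc θ * (g i * H i) = θ * |u i| * |H i| := by rw [hg]; ring
      _ = (cNum i : ℝ) * (-|u (i - 1)| * |H i|)
          + ((bNum 0 : ℝ) - bNum i - cNum i) * (g i * H i)
          + bNum i * (-|u (i + 1)| * |H i|) := by
        rw [← hui, hg]
        ring
      _ ≤ cNum i * (g (i - 1) * H i) + ((bNum 0 : ℝ) - bNum i - cNum i) * (g i * H i)
          + bNum i * (g (i + 1) * H i) := by
        have h1 := mul_le_mul_of_nonneg_left (hb (i - 1)) (Nat.cast_nonneg (α := ℝ) (cNum i))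
        have h2 := mul_le_mul_of_nonneg_left (hb (i + 1)) (Nat.cast_nonneg (α := ℝ) (bNum i))
        linarith
      _ = triOp bNum cNum g i * H i := by
        unfold triOp
        ring
  have hsum := sum_le_sum hterm
  rw [← mul_sum] at hsum
  have hpos : 0 < ∑ i ∈ range (G.diam + 1), g i * H i := by
    refine sum_pos' (fun i _ => ?_) ⟨0, by simp, ?_⟩
    · rw [hg]
      positivity
    · rw [hg, hu0, hH0, abs_one, one_mul]
      exact abs_pos.2 hx
  exact le_of_mul_le_mul_right (hsum.trans hkey.ge) hpos

/-- By the spectral theorem, A - θI is positive semidefinite once no eigenvalue of A is below θ. -/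
theorem adjacency_form_ge (h : IsDistanceRegularWith G bNum cNum) {θ : ℝ} {u : ℕ → ℝ}
    (hu : ∀ i ≤ G.diam, triOp bNum cNum u i = θ * u i) (hu0 : u 0 = 1)
    (hsign : ∀ i, 0 ≤ (-1) ^ i * u i) (f : V → ℝ) :
    θ * ∑ x, f x ^ 2 ≤ ∑ x, f x * ∑ z ∈ G.neighborFinset x, f z := by
  classical
  set M : Matrix V V ℝ := G.adjMatrix ℝ - θ • 1 with hM
  have hmul : ∀ (f : V → ℝ) x, M.mulVec f x = ∑ z ∈ G.neighborFinset x, f z - θ * f x := by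
    intro f x
    rw [hM, Matrix.sub_mulVec, Matrix.smul_mulVec, Matrix.one_mulVec, Pi.sub_apply,
      SimpleGraph.adjMatrix_mulVec_apply]
    simp
  have hherm : M.IsHermitian := by
    rw [Matrix.IsHermitian, Matrix.conjTranspose_eq_transpose_of_trivial, hM,
      Matrix.transpose_sub, SimpleGraph.transpose_adjMatrix, Matrix.transpose_smul,
      Matrix.transpose_one]
  have hpsd : M.PosSemidef := by
    rw [hherm.posSemidef_iff_eigenvalues_nonneg]
    intro j
    have hv := hherm.mulVec_eigenvectorBasis j
    set v : V → ℝ := (hherm.eigenvectorBasis j).ofLp with hvdef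
    have hv0 : v ≠ 0 := by
      intro h0
      apply hherm.eigenvectorBasis.orthonormal.ne_zero j
      ext i
      exact congrFun h0 i
    have heig : IsEigenfunction G (hherm.eigenvalues j + θ) v := by
      intro y
      have h1 := congrFun hv y
      rw [hmul] at h1
      simp only [Pi.smul_apply, smul_eq_mul] at h1
      linarith
    have := h.le_of_isEigenfunction hu hu0 hsign heig hv0
    simpa using this
  have h1 := hpsd.dotProduct_mulVec_nonneg f
  simp only [dotProduct, Pi.star_apply, star_trivial, hmul] at h1
  have h2 : ∑ x, f x * (∑ z ∈ G.neighborFinset x, f z - θ * f x) =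
      ∑ x, f x * ∑ z ∈ G.neighborFinset x, f z - θ * ∑ x, f x ^ 2 := by
    rw [mul_sum, ← sum_sub_distrib]
    refine sum_congr rfl fun x _ => ?_
    ring
  rw [h2] at h1
  linarith

end IsDistanceRegularWith

end Eigenfunctions

/-! ### The numbers [j] -/

section BasicNumbers

theorem basicNumber_zero (b : ℝ) : basicNumber b 0 = 0 := by
  unfold basicNumber
  split_ifs <;> simp

theorem basicNumber_succ (b : ℝ) (i : ℕ) : basicNumber b (i + 1) = b * basicNumber b i + 1 := by
  unfold basicNumber
  split_ifs with h
  · simp [h]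
  · have : b - 1 ≠ 0 := sub_ne_zero.2 h
    field_simp
    ring

theorem basicNumber_one (b : ℝ) : basicNumber b 1 = 1 := by
  rw [show 1 = 0 + 1 from rfl, basicNumber_succ, basicNumber_zero]
  ring

theorem basicNumber_two (b : ℝ) : basicNumber b 2 = b + 1 := by
  rw [show 2 = 1 + 1 from rfl, basicNumber_succ, basicNumber_one]
  ring

theorem basicNumber_three (b : ℝ) : basicNumber b 3 = b ^ 2 + b + 1 := by
  rw [show 3 = 2 + 1 from rfl, basicNumber_succ, basicNumber_two]
  ring

theorem basicNumber_nonneg {b : ℝ} (hb : 0 ≤ b) (i : ℕ) : 0 ≤ basicNumber b i := by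
  induction i with
  | zero => rw [basicNumber_zero]
  | succ i ih =>
    rw [basicNumber_succ]
    positivity

theorem basicNumber_strictMono {b : ℝ} (hb : 1 ≤ b) : StrictMono (basicNumber b) := by
  refine strictMono_nat_of_lt_succ fun i => ?_
  rw [basicNumber_succ]
  nlinarith [basicNumber_nonneg (zero_le_one.trans hb) i]

theorem seven_le_basicNumber {b : ℝ} (hb : 2 ≤ b) {D : ℕ} (hD : 3 ≤ D) :
    7 ≤ basicNumber b D := by
  have h := (basicNumber_strictMono (by linarith : (1 : ℝ) ≤ b)).monotone hD
  rw [basicNumber_three] at h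
  nlinarith

end BasicNumbers

/-! ### Integrality of b and nonnegativity of α -/

section IntegerRoots

open Polynomial in
theorem exists_int_eq_of_rat_quadratic {w : ℚ} {p q : ℤ} (h : w ^ 2 + p * w + q = 0) :
    ∃ n : ℤ, w = n := by
  have hint : IsIntegral ℤ w := by
    refine ⟨X ^ 2 + C p * X + C q, ?_, ?_⟩
    · monicity!
    · simp only [eval₂_add, eval₂_mul, eval₂_pow, eval₂_X, eval₂_C]
      simpa using h
  obtain ⟨n, hn⟩ := IsIntegrallyClosed.isIntegral_iff.1 hint
  exact ⟨n, by simpa using hn.symm⟩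

theorem exists_int_eq_of_quadratic_of_linear {b : ℝ} {p q u v : ℤ}
    (h : b ^ 2 + p * b + q = 0) (hu : u ≠ 0) (h' : u * b + v = 0) : ∃ n : ℤ, b = n := by
  have hu' : (u : ℝ) ≠ 0 := by exact_mod_cast hu
  have hb : b = ((-v / u : ℚ) : ℝ) := by
    push_cast
    rw [eq_div_iff hu']
    linarith
  rw [hb] at h
  obtain ⟨n, hn⟩ := exists_int_eq_of_rat_quadratic (w := (-v / u : ℚ)) (p := p) (q := q)
    (by exact_mod_cast h)
  exact ⟨n, by rw [hb, hn]; simp⟩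

end IntegerRoots

/-- `G` is distance-regular with the given intersection numbers, and these are of classical
form. -/
structure IsClassicalWith {V : Type*} (G : SimpleGraph V) (bNum cNum : ℕ → ℕ) (D : ℕ)
    (b α β : ℝ) : Prop where
  isDistanceRegularWith : IsDistanceRegularWith G bNum cNum
  diam_eq : G.diam = D
  bNum_eq : ∀ i ≤ D,
    (bNum i : ℝ) = (basicNumber b D - basicNumber b i) * (β - α * basicNumber b i)
  cNum_eq : ∀ i ≤ D, (cNum i : ℝ) = basicNumber b i * (1 + α * basicNumber b (i - 1))

theorem HasClassicalParameters.exists_isClassicalWith {V : Type*} [Finite V] {G : SimpleGraph V}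
    {D : ℕ} {b α β : ℝ} (hG : HasClassicalParameters G D b α β) :
    ∃ bNum cNum, IsClassicalWith G bNum cNum D b α β := by
  classical
  have := Fintype.ofFinite V
  obtain ⟨bNum, cNum, h, hD, hb, hc⟩ := hG
  refine ⟨bNum, cNum, h, hD, fun i hi => ?_, fun i hi => ?_⟩
  · rcases hi.lt_or_eq with hi | rfl
    · exact hb i hi
    · rw [h.bNum_eq_zero i hD.le]
      simp
  · rcases Nat.eq_zero_or_pos i with rfl | h0
    · rw [h.cNum_zero, basicNumber_zero]
      simp
    · exact hc i h0 hi

namespace IsClassicalWith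

variable {V : Type*} {G : SimpleGraph V} {bNum cNum : ℕ → ℕ} {D : ℕ} {b α β : ℝ}

theorem bNum_zero_eq (h : IsClassicalWith G bNum cNum D b α β) :
    (bNum 0 : ℝ) = basicNumber b D * β := by
  rw [h.bNum_eq 0 (Nat.zero_le _), basicNumber_zero]
  ring

theorem bNum_one_eq (h : IsClassicalWith G bNum cNum D b α β) (hD : 1 ≤ D) :
    (bNum 1 : ℝ) = (basicNumber b D - 1) * (β - α) := by
  rw [h.bNum_eq 1 hD, basicNumber_one, mul_one]

theorem cNum_one_eq (h : IsClassicalWith G bNum cNum D b α β) (hD : 1 ≤ D) : cNum 1 = 1 := by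
  have := h.cNum_eq 1 hD
  rw [Nat.sub_self, basicNumber_zero, basicNumber_one, mul_zero, add_zero, mul_one] at this
  exact_mod_cast this

theorem cNum_two_eq (h : IsClassicalWith G bNum cNum D b α β) (hD : 2 ≤ D) :
    (cNum 2 : ℝ) = (b + 1) * (1 + α) := by
  rw [h.cNum_eq 2 hD, basicNumber_two]
  simp [basicNumber_one]

theorem cNum_three_eq (h : IsClassicalWith G bNum cNum D b α β) (hD : 3 ≤ D) :
    (cNum 3 : ℝ) = (b ^ 2 + b + 1) * (1 + α * (b + 1)) := by
  rw [h.cNum_eq 3 hD, basicNumber_three]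
  simp [basicNumber_two]

variable [Finite V]

theorem bNum_pos (h : IsClassicalWith G bNum cNum D b α β) {i : ℕ} (hi : i < D) :
    0 < bNum i := by
  classical
  have := Fintype.ofFinite V
  exact h.isDistanceRegularWith.bNum_pos (by rwa [h.diam_eq])

theorem cNum_pos (h : IsClassicalWith G bNum cNum D b α β) {i : ℕ} (hi : 1 ≤ i) (hi' : i ≤ D) :
    0 < cNum i := by
  classical
  have := Fintype.ofFinite V
  exact h.isDistanceRegularWith.cNum_pos hi (by rwa [h.diam_eq])

/-- If `a₁ + 1 ≥ c₂`, then the base `b` of the classical parameters is an integer. -/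
theorem exists_int_eq_base (h : IsClassicalWith G bNum cNum D b α β) (hD : 3 ≤ D)
    (hle : (b + 1) * (1 + α) ≤ β + α * (basicNumber b D - 1)) : ∃ n : ℤ, b = n := by
  set r := basicNumber b D with hr
  have hb0 := h.bNum_zero_eq
  have hb1 := h.bNum_one_eq (by omega)
  have hb2 := h.bNum_eq 2 (by omega)
  have hc2 := h.cNum_two_eq (by omega)
  have hc3 := h.cNum_three_eq hD
  rw [basicNumber_two] at hb2
  rw [← hr] at hb0 hb1 hb2
  obtain ⟨c2, hc2d⟩ : ∃ c : ℤ, c = cNum 2 := ⟨_, rfl⟩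
  obtain ⟨c3, hc3d⟩ : ∃ c : ℤ, c = cNum 3 := ⟨_, rfl⟩
  set t : ℤ := (bNum 0 : ℤ) - bNum 1 with ht
  set a2 : ℤ := (bNum 0 : ℤ) - bNum 2 - c2 with ha2
  have hc2r : (c2 : ℝ) = (b + 1) * (1 + α) := by rw [hc2d]; exact_mod_cast hc2
  have hc3r : (c3 : ℝ) = (b ^ 2 + b + 1) * (1 + α * (b + 1)) := by rw [hc3d]; exact_mod_cast hc3
  have htr : (t : ℝ) = β + α * (r - 1) := by
    rw [ht]
    push_cast
    rw [hb0, hb1]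
    ring
  have ha2r : (a2 : ℝ) = (b + 1) * (t - 1 - α * (b + 1)) := by
    rw [ha2]
    push_cast
    rw [hb0, hb2, hc2r, htr]
    ring
  have hc3pos : 0 < c3 := by
    rw [hc3d]
    exact_mod_cast h.cNum_pos (by omega) hD
  have hct : c2 ≤ t := by
    have : (c2 : ℝ) ≤ t := by rw [hc2r, htr]; exact hle
    exact_mod_cast this
  -- Here t = a₁ + 1. Eliminating α from a₂ and from c₃ gives a monic integer quadratic and a monic
  -- integer cubic with root b. The remainder of the cubic modulo the quadratic is ub + v.
  set p : ℤ := t - c2 + 1 with hp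
  set q : ℤ := t - c2 - a2 with hq
  set u : ℤ := 1 - c2 - q + p * t with hu
  set v : ℤ := c3 - c2 + q * t with hv
  have hquad : b ^ 2 + (p : ℝ) * b + q = 0 := by
    rw [hp, hq]
    push_cast
    rw [ha2r, hc2r]
    ring
  have hlin : (u : ℝ) * b + v = 0 := by
    have hcub : b ^ 3 - ((c2 : ℝ) - 1) * b ^ 2 - ((c2 : ℝ) - 1) * b + (c3 - c2) = 0 := by
      rw [hc3r, hc2r]
      ring
    have hpr : (p : ℝ) = t - c2 + 1 := by rw [hp]; push_cast; ring
    rw [hu, hv]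
    push_cast
    rw [hpr] at hquad ⊢
    linear_combination hcub - (b - t) * hquad
  by_cases hu0 : u = 0
  · exfalso
    have hv0 : v = 0 := by
      rw [hu0] at hlin
      have : (v : ℝ) = 0 := by simpa using hlin
      exact_mod_cast this
    -- With zero remainder, t is a root of the cubic. Then c₂ ≤ t forces c₃ ≤ 0.
    have hc3eq : c3 = (t ^ 2 + t + 1) * (c2 - t) := by
      have h1 : 1 - c2 - q + p * t = 0 := hu0
      have h2 : c3 - c2 + q * t = 0 := hv0
      rw [hp] at h1
      linear_combination h2 + t * h1
    nlinarith [sq_nonneg (t + 1), sq_nonneg t, sq_nonneg (2 * t + 1)]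
  · exact exists_int_eq_of_quadratic_of_linear hquad hu0 hlin

/-- Supplies c₂ ≤ a₁ + 1 before the sign of α is known. For negative α, c₃ > 0 and b ≥ 2 still give
α ≥ -1/3. -/
theorem base_le_of_large (h : IsClassicalWith G bNum cNum D b α β) (hb : 2 ≤ b) (hD : 3 ≤ D)
    (hβ : (1 / 3 : ℝ) * (8 * α * b + 8 * b + 5 * α) * basicNumber b D ≤ β) :
    (b + 1) * (1 + α) ≤ β + α * (basicNumber b D - 1) := by
  have hr := seven_le_basicNumber hb hD
  set r := basicNumber b D
  have hc3 := h.cNum_three_eq hD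
  have hc3pos : (0 : ℝ) < cNum 3 := by exact_mod_cast h.cNum_pos (by omega) hD
  rw [hc3] at hc3pos
  have hα1 : 0 < 1 + α * (b + 1) := by
    refine (pos_iff_pos_of_mul_pos hc3pos).1 ?_
    positivity
  rcases le_or_gt 0 α with h0 | h0
  · have h1 : 0 ≤ b * (1 + α) * (r - 7) := by
      have : 0 ≤ r - 7 := by linarith
      positivity
    have h2 : 0 ≤ α * (r - 1) := mul_nonneg h0 (by linarith)
    have h3 : 0 ≤ α * r := mul_nonneg h0 (by linarith)
    nlinarith
  · have hα3 : -(1 / 3) ≤ α := by nlinarith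
    have h1 : 0 ≤ (8 * α * b + 8 * b + 5 * α - (16 / 3 * b - 5 / 3)) * r := by
      refine mul_nonneg ?_ (by linarith)
      nlinarith
    have h2 : 0 ≤ (α + 1 / 3) * (r - 1) := mul_nonneg (by linarith) (by linarith)
    have h3 : 0 ≤ (16 * b - 8) * (r - 7) := mul_nonneg (by linarith) (by linarith)
    have h4 : (b + 1) * (1 + α) ≤ b + 1 := by nlinarith
    linarith

/-- Positivity of c₃ gives α > -1/(b + 1). A negative α would then yield b < c₂ < b + 1 with b and
c₂ integers. -/
theorem alpha_nonneg (h : IsClassicalWith G bNum cNum D b α β) (hb : 2 ≤ b) (hD : 3 ≤ D)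
    (hβ : (1 / 3 : ℝ) * (8 * α * b + 8 * b + 5 * α) * basicNumber b D ≤ β) : 0 ≤ α := by
  obtain ⟨n, hn⟩ := h.exists_int_eq_base hD (h.base_le_of_large hb hD hβ)
  by_contra! h0
  have hc2 := h.cNum_two_eq (by omega)
  have hc3 := h.cNum_three_eq hD
  have hc3pos : (0 : ℝ) < cNum 3 := by exact_mod_cast h.cNum_pos (by omega) hD
  rw [hc3] at hc3pos
  have hα1 : 0 < 1 + α * (b + 1) := by
    refine (pos_iff_pos_of_mul_pos hc3pos).1 ?_
    positivity
  have h1 : b < cNum 2 := by rw [hc2]; linarith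
  have h2 : (cNum 2 : ℝ) < b + 1 := by rw [hc2]; nlinarith
  rw [hn] at h1 h2
  have h3 : n < cNum 2 := by exact_mod_cast h1
  have h4 : (cNum 2 : ℤ) < n + 1 := by exact_mod_cast h2
  omega

end IsClassicalWith

/-! ### Line systems: incidence counts and dimension -/

section LineSystems

variable {V : Type*} [Fintype V] [DecidableEq V] {G : SimpleGraph V} [DecidableRel G.Adj]

theorem HasCommonNeighborBounds.isSPLSWith {k lam m s : ℕ}
    (h : HasCommonNeighborBounds G k lam m) (hs : 2 ≤ s) (hlam : 2 * s * m ≤ lam + m)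
    (hk : 2 * k + s * (s + 1) * m < 2 * (s + 1) * (lam + 1)) {x y : V} (hxy : G.Adj x y) :
    IsSPLSWith G lam (m + 1) s := by
  have hτ : (lam : ℤ) + 2 - (((m + 1 : ℕ) : ℤ) - 1) * ((s : ℤ) - 1) =
      lam + 2 - m * ((s : ℤ) - 1) := by
    push_cast
    ring
  have hpg : (splsSpace G lam (m + 1) s).pointGraph = G := by
    ext x y
    constructor
    · rintro ⟨hne, ⟨C, hC⟩, hx, hy⟩
      exact hC.1.1 hx hy hne
    · intro hadj
      obtain ⟨C, hC, hx, hy⟩ := h.exists_line_of_adj hlam hk hadj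
      exact ⟨hadj.ne, ⟨C, by rwa [hτ]⟩, hx, hy⟩
  refine ⟨by omega, hs, ⟨⟨x⟩, ?_, ?_⟩, hpg, ?_, ?_, ?_⟩
  · obtain ⟨C, hC, -, -⟩ := h.exists_line_of_adj hlam hk hxy
    exact ⟨⟨C, by rwa [hτ]⟩⟩
  · rintro p q hpq ⟨C, hC⟩ ⟨C', hC'⟩ hp hq hp' hq'
    rw [hτ] at hC hC'
    exact Subtype.ext (h.line_unique hlam hC hC' hpq hp hp' hq hq')
  · have : (2 * s * m : ℤ) ≤ lam + m := by exact_mod_cast hlam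
    push_cast
    linarith
  · intro p
    have h1 := h.card_lines_le (by omega) hlam hk p
    rw [IncidenceStructure.pointOrder, ← Subtype.val_injective.encard_image]
    have h2 : (Subtype.val '' {l | (splsSpace G lam (m + 1) s).Inc p l} : Set (Finset V)) ⊆
        {C | C ∈ largeMaximalCliques G ((lam : ℤ) + 2 - m * ((s : ℤ) - 1)) ∧ p ∈ C} := by
      rintro _ ⟨⟨C, hC⟩, hp, rfl⟩
      rw [hτ] at hC
      exact ⟨hC, hp⟩
    refine (Set.encard_le_encard h2).trans ?_
    rw [← (Set.toFinite _).cast_ncard_eq]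
    exact_mod_cast h1
  · refine iSup_le fun p => iSup_le fun l => iSup_le fun hp => ?_
    have h1 := h.card_clique_inter_le l.2.1 hp
    have h2 : {y | (splsSpace G lam (m + 1) s).Inc y l ∧
        (splsSpace G lam (m + 1) s).pointGraph.Adj p y} =
        ((l.1 ∩ G.neighborFinset p : Finset V) : Set V) := by
      rw [hpg]
      ext y
      rw [coe_inter, Set.mem_inter_iff, mem_coe, mem_coe, SimpleGraph.mem_neighborFinset]
      rfl
    rw [IncidenceStructure.tauAt, h2, Set.encard_coe_eq_coe_finsetCard]
    exact_mod_cast h1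

/-- A family of nonempty maximal cliques such that every edge is in exactly one of them. -/
structure IsCliqueLineSystem (G : SimpleGraph V) (L : Finset (Finset V)) : Prop where
  nonempty : ∀ C ∈ L, C.Nonempty
  maximal : ∀ C ∈ L, Maximal G.IsClique (C : Set V)
  unique : ∀ C ∈ L, ∀ C' ∈ L, ∀ x y, x ≠ y → x ∈ C → x ∈ C' → y ∈ C → y ∈ C' → C = C'
  cover : ∀ x y, G.Adj x y → ∃ C ∈ L, x ∈ C ∧ y ∈ C

theorem IsCliqueLineSystem.sum_neighborFinset {L : Finset (Finset V)}
    (hL : IsCliqueLineSystem G L) (f : V → ℝ) (x : V) :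
    ∑ C ∈ L with x ∈ C, ∑ y ∈ C.erase x, f y = ∑ y ∈ G.neighborFinset x, f y := by
  rw [← sum_biUnion]
  · congr 1
    ext y
    simp only [mem_biUnion, mem_filter, SimpleGraph.mem_neighborFinset, mem_erase]
    constructor
    · rintro ⟨C, ⟨hC, hx⟩, hne, hy⟩
      exact (hL.maximal C hC).1 hx hy hne.symm
    · intro hxy
      obtain ⟨C, hC, hx, hy⟩ := hL.cover x y hxy
      exact ⟨C, ⟨hC, hx⟩, hxy.ne', hy⟩
  · intro C hC C' hC' hne
    rw [mem_coe, mem_filter] at hC hC'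
    refine disjoint_left.2 fun y hy hy' => hne ?_
    exact hL.unique C hC.1 C' hC'.1 x y (ne_of_mem_erase hy).symm hC.2 hC'.2
      (mem_of_mem_erase hy) (mem_of_mem_erase hy')

/-- With N the vertex-line incidence matrix, this is NNᵀ = A plus the diagonal matrix of line
counts. -/
theorem IsCliqueLineSystem.sum_lines {L : Finset (Finset V)}
    (hL : IsCliqueLineSystem G L) (f : V → ℝ) (x : V) :
    ∑ C ∈ L with x ∈ C, ∑ y ∈ C, f y =
      #{C ∈ L | x ∈ C} * f x + ∑ y ∈ G.neighborFinset x, f y := by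
  rw [← hL.sum_neighborFinset f x, ← nsmul_eq_mul, ← sum_const, ← sum_add_distrib]
  refine sum_congr rfl fun C hC => ?_
  rw [add_sum_erase _ _ (mem_filter.1 hC).2]

/-- If the adjacency form is bounded below by `-r`, there are at most as many vertices on more
than `r` lines as there are lines. -/
theorem IsCliqueLineSystem.card_vertices_on_many_lines_le {L : Finset (Finset V)}
    (hL : IsCliqueLineSystem G L) {r : ℝ}
    (hr : ∀ f : V → ℝ, -r * ∑ x, f x ^ 2 ≤ ∑ x, f x * ∑ z ∈ G.neighborFinset x, f z) :
    #{x : V | r < #{C ∈ L | x ∈ C}} ≤ #L := by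
  set B : Finset V := {x : V | r < #{C ∈ L | x ∈ C}} with hB
  by_contra! hlt
  -- A kernel vector vanishes off B and sums to zero on each line. If |L| < |B|, a nonzero one
  -- exists; on it A acts as minus the number of lines, which exceeds r on B, against `hr`.
  let T : (V → ℝ) →ₗ[ℝ] ((↥Bᶜ ⊕ ↥L) → ℝ) :=
    LinearMap.pi (Sum.elim (fun x => LinearMap.proj x.1)
      (fun C => ∑ y ∈ C.1, LinearMap.proj y))
  have hker : LinearMap.ker T ≠ ⊥ := by
    apply LinearMap.ker_ne_bot_of_finrank_lt
    rw [Module.finrank_fintype_fun_eq_card, Module.finrank_fintype_fun_eq_card, Fintype.card_sum,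
      Fintype.card_coe, Fintype.card_coe, ← card_add_card_compl B]
    omega
  obtain ⟨f, hf, hf0⟩ := Submodule.exists_mem_ne_zero_of_ne_bot hker
  have hoff : ∀ x, x ∉ B → f x = 0 := fun x hx =>
    congrFun (LinearMap.mem_ker.1 hf) (Sum.inl ⟨x, mem_compl.2 hx⟩)
  have hline : ∀ C ∈ L, ∑ y ∈ C, f y = 0 := by
    intro C hC
    have := congrFun (LinearMap.mem_ker.1 hf) (Sum.inr ⟨C, hC⟩)
    simpa [T] using this
  have hsum : ∀ x, ∑ z ∈ G.neighborFinset x, f z = -(#{C ∈ L | x ∈ C} * f x) := by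
    intro x
    have := hL.sum_lines f x
    rw [sum_eq_zero fun C hC => hline C (mem_filter.1 hC).1] at this
    linarith
  have h1 := hr f
  have h2 : ∑ x, ((#{C ∈ L | x ∈ C} : ℝ) - r) * f x ^ 2 ≤ 0 := by
    rw [mul_sum, ← sub_nonneg, ← sum_sub_distrib] at h1
    have : ∑ x, (f x * ∑ z ∈ G.neighborFinset x, f z - -r * f x ^ 2) =
        -∑ x, ((#{C ∈ L | x ∈ C} : ℝ) - r) * f x ^ 2 := by
      rw [← sum_neg_distrib]
      refine sum_congr rfl fun x _ => ?_
      rw [hsum]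
      ring
    linarith
  obtain ⟨x, hx⟩ := Function.ne_iff.1 hf0
  have hxB : x ∈ B := by
    by_contra h
    exact hx (hoff x h)
  refine absurd h2 (not_le.2 (sum_pos' (fun y _ => ?_) ⟨x, mem_univ _, ?_⟩))
  · by_cases hy : y ∈ B
    · have : r < #{C ∈ L | y ∈ C} := (mem_filter.1 hy).2
      exact mul_nonneg (by linarith) (sq_nonneg _)
    · rw [hoff y hy]
      simp
  · have : r < #{C ∈ L | x ∈ C} := (mem_filter.1 hxB).2
    have hx' : f x ≠ 0 := hx
    exact mul_pos (by linarith) (by positivity)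

theorem card_mul_le_of_forall_card_lines_le {L : Finset (Finset V)} {t s : ℝ}
    (ht : ∀ C ∈ L, t ≤ #C) (hs : ∀ x : V, (#{C ∈ L | x ∈ C} : ℝ) ≤ s) :
    #L * t ≤ Fintype.card V * s := by
  have h1 : ∑ C ∈ L, (#C : ℝ) = ∑ x : V, (#{C ∈ L | x ∈ C} : ℝ) := by
    have h2 : ∑ C ∈ L, #C = ∑ x : V, #{C ∈ L | x ∈ C} := by
      simp only [card_filter]
      rw [sum_comm]
      simp
    exact_mod_cast h2
  calc #L * t = ∑ C ∈ L, t := by rw [sum_const, nsmul_eq_mul]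
    _ ≤ ∑ C ∈ L, (#C : ℝ) := sum_le_sum ht
    _ = ∑ x : V, (#{C ∈ L | x ∈ C} : ℝ) := h1
    _ ≤ ∑ x : V, s := sum_le_sum fun x _ => hs x
    _ = Fintype.card V * s := by rw [sum_const, nsmul_eq_mul, card_univ]

/-- If fewer than half of the vertices are excluded, two remaining ones are at distance `i`. -/
theorem IsDistanceRegularWith.exists_dist_eq_of_card_lt {bNum cNum : ℕ → ℕ}
    (h : IsDistanceRegularWith G bNum cNum) {i : ℕ} (hi : i ≤ G.diam) {B : Finset V}
    (hB : 2 * #B < Fintype.card V) : ∃ x y, x ∉ B ∧ y ∉ B ∧ G.dist x y = i := by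
  obtain ⟨l, hl⟩ := h.exists_sphereSum_eq (bNum 0) i
  have hone : IsEigenfunction G (bNum 0) fun _ => 1 := by
    intro y
    simp [← h.card_neighborFinset y]
  have hcard : ∀ x, (#{y | G.dist x y = i} : ℝ) = l := by
    intro x
    have := hl _ hone x
    simpa [sphereSum] using this
  obtain ⟨x₀, y₀, hxy⟩ := h.connected.exists_dist_eq hi
  have hconst : ∀ x, #{y | G.dist x y = i} = #{y | G.dist x₀ y = i} := by
    intro x
    have := (hcard x).trans (hcard x₀).symm
    exact_mod_cast this
  have hpos : 0 < #{y | G.dist x₀ y = i} := card_pos.2 ⟨y₀, by simpa using hxy⟩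
  by_contra! hno
  -- All spheres of radius i have equal size because constants are eigenfunctions. If no pair
  -- outside B is at distance i, double counting gives |Bᶜ| ≤ |B|.
  have hle := card_mul_le_card_mul (fun x y => G.dist x y = i) (s := Bᶜ) (t := B)
    (m := #{y | G.dist x₀ y = i}) (n := #{y | G.dist x₀ y = i}) ?_ ?_
  · have := Nat.le_of_mul_le_mul_right hle hpos
    rw [card_compl] at this
    omega
  · intro x hx
    rw [← hconst x]
    refine card_le_card fun y hy => ?_
    have hy : G.dist x y = i := by simpa using hy
    rw [mem_bipartiteAbove]
    refine ⟨?_, hy⟩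
    by_contra hyB
    exact hno x y (mem_compl.1 hx) hyB hy
  · intro y _
    rw [← hconst y]
    refine card_le_card fun x hx => ?_
    rw [mem_bipartiteBelow] at hx
    rw [mem_filter]
    exact ⟨mem_univ _, by rw [SimpleGraph.dist_comm]; exact hx.2⟩

end LineSystems

/-- The standard sequence of the eigenvalue `-[D]` of a graph with classical parameters. -/
noncomputable def minStdSeq (b α β : ℝ) (i : ℕ) : ℝ :=
  ∏ j ∈ range i, -((1 + α * basicNumber b j) / |β - α * basicNumber b j|)

theorem minStdSeq_zero (b α β : ℝ) : minStdSeq b α β 0 = 1 := by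
  simp [minStdSeq]

theorem minStdSeq_succ (b α β : ℝ) (i : ℕ) : minStdSeq b α β (i + 1) =
    minStdSeq b α β i * -((1 + α * basicNumber b i) / |β - α * basicNumber b i|) := by
  simp [minStdSeq, prod_range_succ]

/-- The absolute value in `minStdSeq` secures alternation at all indices, even past the diameter,
where β - α[j] may fail to be positive. -/
theorem minStdSeq_sign {b α : ℝ} (hb : 0 ≤ b) (hα : 0 ≤ α) (β : ℝ) (i : ℕ) :
    0 ≤ (-1) ^ i * minStdSeq b α β i := by
  induction i with
  | zero => simp [minStdSeq]
  | succ i ih =>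
    have h1 := basicNumber_nonneg hb i
    have h2 : 0 ≤ (1 + α * basicNumber b i) / |β - α * basicNumber b i| := by positivity
    rw [minStdSeq_succ, pow_succ]
    nlinarith [mul_nonneg ih h2]

/-! ### The eigenvalue -[D] and Delsarte cliques -/

namespace IsClassicalWith

variable {V : Type*} [Fintype V] {G : SimpleGraph V} {bNum cNum : ℕ → ℕ} {D : ℕ} {b α β : ℝ}

theorem alpha_mul_lt_beta (h : IsClassicalWith G bNum cNum D b α β) (hb : 1 ≤ b) {i : ℕ}
    (hi : i < D) : 0 < β - α * basicNumber b i := by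
  have h1 : (0 : ℝ) < bNum i := by exact_mod_cast h.bNum_pos hi
  rw [h.bNum_eq i hi.le] at h1
  exact (pos_iff_pos_of_mul_pos h1).1 (sub_pos.2 (basicNumber_strictMono hb hi))

theorem minStdSeq_succ_mul (h : IsClassicalWith G bNum cNum D b α β) (hb : 1 ≤ b) {i : ℕ}
    (hi : i < D) : minStdSeq b α β (i + 1) * (β - α * basicNumber b i) =
      -(minStdSeq b α β i * (1 + α * basicNumber b i)) := by
  have h1 := h.alpha_mul_lt_beta hb hi
  rw [minStdSeq_succ, abs_of_pos h1]
  field_simp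

theorem triOp_minStdSeq (h : IsClassicalWith G bNum cNum D b α β) (hb : 1 ≤ b) {i : ℕ}
    (hi : i ≤ G.diam) : triOp bNum cNum (minStdSeq b α β) i =
      -basicNumber b D * minStdSeq b α β i := by
  rw [h.diam_eq] at hi
  have h1 : (cNum i : ℝ) * minStdSeq b α β (i - 1) =
      -(basicNumber b i * (β - α * basicNumber b (i - 1)) * minStdSeq b α β i) := by
    rcases i with _ | i
    · rw [h.cNum_eq 0 hi, basicNumber_zero]
      simp
    · rw [h.cNum_eq _ hi, Nat.add_sub_cancel]
      linear_combination basicNumber b (i + 1) * h.minStdSeq_succ_mul hb (i := i) (by omega)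
  have h2 : (bNum i : ℝ) * minStdSeq b α β (i + 1) =
      -((basicNumber b D - basicNumber b i) * (1 + α * basicNumber b i) * minStdSeq b α β i) := by
    rw [h.bNum_eq i hi]
    rcases hi.lt_or_eq with hi | rfl
    · linear_combination (basicNumber b D - basicNumber b i) * h.minStdSeq_succ_mul hb hi
    · simp
  rw [triOp, h1, h2, h.bNum_zero_eq, h.bNum_eq i hi, h.cNum_eq i hi]
  ring

theorem beta_pos (h : IsClassicalWith G bNum cNum D b α β) (hb : 1 ≤ b) (hD : 1 ≤ D) :
    0 < β := by
  have := h.alpha_mul_lt_beta hb (i := 0) (by omega)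
  rwa [basicNumber_zero, mul_zero, sub_zero] at this

theorem minStdSeq_one_mul (h : IsClassicalWith G bNum cNum D b α β) (hb : 1 ≤ b) (hD : 1 ≤ D) :
    minStdSeq b α β 1 * β = -1 := by
  have := h.minStdSeq_succ_mul hb (i := 0) (by omega)
  simpa [basicNumber_zero, minStdSeq_zero] using this

variable [DecidableRel G.Adj]

theorem adjacency_form_ge (h : IsClassicalWith G bNum cNum D b α β) (hb : 1 ≤ b) (hα : 0 ≤ α)
    (f : V → ℝ) :
    -basicNumber b D * ∑ x, f x ^ 2 ≤ ∑ x, f x * ∑ z ∈ G.neighborFinset x, f z :=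
  h.isDistanceRegularWith.adjacency_form_ge (fun _ hi => h.triOp_minStdSeq hb hi)
    (minStdSeq_zero _ _ _) (minStdSeq_sign (by linarith) hα β) f

/-- The Delsarte bound. -/
theorem card_clique_le (h : IsClassicalWith G bNum cNum D b α β) (hb : 1 ≤ b) (hD : 1 ≤ D)
    {C : Finset V} (hC : G.IsClique (C : Set V)) (hne : C.Nonempty) : (#C : ℝ) ≤ 1 + β := by
  obtain ⟨l, hl, hg⟩ := h.isDistanceRegularWith.exists_clique_gram
    (fun _ hi => h.triOp_minStdSeq hb hi) (minStdSeq_zero _ _ _)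
  have h1 := hg C hC
  have hβ := h.beta_pos hb hD
  have hu := h.minStdSeq_one_mul hb hD
  -- The Gram identity is a sum of squares, so 1 + (#C - 1)u₁ ≥ 0 with u₁ = -1/β.
  have h2 : 0 ≤ l * (#C * (1 + ((#C : ℝ) - 1) * minStdSeq b α β 1)) := by
    rw [← h1]
    positivity
  have hc : (0 : ℝ) < #C := by exact_mod_cast hne.card_pos
  have h3 := nonneg_of_mul_nonneg_right (nonneg_of_mul_nonneg_right h2 hl) hc
  nlinarith [mul_nonneg h3 hβ.le]

/-- A vertex outside a clique attaining the Delsarte bound that has a neighbour in it has exactly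
`1 + α` neighbours in it. -/
theorem card_delsarte_clique_inter [DecidableEq V] (h : IsClassicalWith G bNum cNum D b α β) (hb : 1 ≤ b)
    (hD : 2 ≤ D) {C : Finset V} (hC : G.IsClique (C : Set V)) (hcard : (#C : ℝ) = 1 + β)
    {x : V} (hx : x ∉ C) (hn : (C ∩ G.neighborFinset x).Nonempty) :
    (#(C ∩ G.neighborFinset x) : ℝ) = 1 + α := by
  obtain ⟨l, hl, hg⟩ := h.isDistanceRegularWith.exists_clique_gram
    (fun _ hi => h.triOp_minStdSeq hb hi) (minStdSeq_zero _ _ _)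
  have h1 := hg C hC
  have hβ := h.beta_pos hb (by omega)
  have hαβ := h.alpha_mul_lt_beta hb (i := 1) (by omega)
  have hu1 := h.minStdSeq_one_mul hb (by omega)
  have hu2 := h.minStdSeq_succ_mul hb (i := 1) (by omega)
  rw [basicNumber_one, mul_one] at hu2 hαβ
  have hz : (1 : ℝ) + ((#C : ℝ) - 1) * minStdSeq b α β 1 = 0 := by
    rw [hcard]
    linarith
  -- Equality kills every square. As x sees C only at distances 1 and 2, this reads nu₁ + (1 + β -
  -- n)u₂ = 0, where n counts its neighbours in C.
  rw [hz, mul_zero, mul_zero, sum_eq_zero_iff_of_nonneg fun _ _ => sq_nonneg _] at h1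
  have h2 : ∑ y ∈ C, minStdSeq b α β (G.dist x y) = 0 := by
    simpa using h1 x (mem_univ _)
  obtain ⟨z, hz⟩ := hn
  rw [mem_inter, SimpleGraph.mem_neighborFinset] at hz
  have h3 : ∀ y ∈ C, minStdSeq b α β (G.dist x y) = minStdSeq b α β 2 +
      if y ∈ G.neighborFinset x then minStdSeq b α β 1 - minStdSeq b α β 2 else 0 := by
    intro y hy
    simp only [SimpleGraph.mem_neighborFinset]
    by_cases hxy : G.Adj x y
    · rw [SimpleGraph.dist_eq_one_iff_adj.2 hxy, if_pos hxy]
      ring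
    · have hd : G.dist x y = 2 := by
        have hzy : z ≠ y := by rintro rfl; exact hxy hz.2
        have t := h.isDistanceRegularWith.connected.dist_triangle (u := x) (v := z) (w := y)
        rw [SimpleGraph.dist_eq_one_iff_adj.2 hz.2,
          SimpleGraph.dist_eq_one_iff_adj.2 (hC hz.1 hy hzy)] at t
        have h4 : G.dist x y ≠ 0 := by
          rw [Ne, h.isDistanceRegularWith.connected.dist_eq_zero_iff]
          rintro rfl
          exact hx hy
        have h5 : G.dist x y ≠ 1 := by rwa [Ne, SimpleGraph.dist_eq_one_iff_adj]
        omega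
      rw [hd, if_neg hxy, add_zero]
  rw [sum_congr rfl h3, sum_add_distrib, sum_const, ← sum_filter, filter_mem_eq_inter, sum_const,
    nsmul_eq_mul, nsmul_eq_mul, hcard] at h2
  set n : ℝ := (#(C ∩ G.neighborFinset x) : ℝ)
  have h4 : (1 + β) * (1 + α - n) = 0 := by
    norm_num at hu2
    linear_combination β * (β - α) * h2 - ((1 + β - n) * β) * hu2
      - ((1 + β - n) * (-(1 + α)) + n * (β - α)) * hu1
  have h5 : 1 + α - n = 0 := by
    rcases mul_eq_zero.1 h4 with h6 | h6
    · linarith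
    · exact h6
  linarith

end IsClassicalWith

/-! ### Vertices on at most [D] lines -/

namespace IsClassicalWith

variable {V : Type*} [Fintype V] {G : SimpleGraph V} {bNum cNum : ℕ → ℕ} {D : ℕ} {b α β : ℝ}
  [DecidableRel G.Adj] [DecidableEq V]

/-- All lines through a vertex on at most `[D]` lines attain the Delsarte bound. -/
theorem card_line_eq (h : IsClassicalWith G bNum cNum D b α β) (hb : 1 ≤ b) (hD : 1 ≤ D)
    {L : Finset (Finset V)} (hL : IsCliqueLineSystem G L) {x : V}
    (hx : (#{C ∈ L | x ∈ C} : ℝ) ≤ basicNumber b D) {C : Finset V} (hC : C ∈ L) (hxC : x ∈ C) :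
    (#C : ℝ) = 1 + β := by
  have hβ := h.beta_pos hb hD
  have hnn : ∀ C ∈ L.filter (x ∈ ·), 0 ≤ 1 + β - (#C : ℝ) := by
    intro C hC
    have hC := (mem_filter.1 hC).1
    have := h.card_clique_le hb hD (hL.maximal C hC).1 (hL.nonempty C hC)
    linarith
  have hsum : ∑ C ∈ L with x ∈ C, (#C : ℝ) =
      #{C ∈ L | x ∈ C} + basicNumber b D * β := by
    have := hL.sum_lines (fun _ => 1) x
    simp only [sum_const, nsmul_eq_mul, mul_one] at this
    rw [this, h.isDistanceRegularWith.card_neighborFinset, h.bNum_zero_eq]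
  -- The b₀ = [D]β neighbours of x are split among at most [D] lines, each contributing at most β,
  -- so every line is full.
  have hzero : ∑ C ∈ L with x ∈ C, (1 + β - (#C : ℝ)) = 0 := by
    refine le_antisymm ?_ (sum_nonneg hnn)
    rw [sum_sub_distrib, sum_const, hsum, nsmul_eq_mul]
    nlinarith
  have := (sum_eq_zero_iff_of_nonneg hnn).1 hzero C (mem_filter.2 ⟨hC, hxC⟩)
  linarith

/-- If two vertices at distance two lie on at most `[D]` lines each, then `α` is an integer and
`α ≤ b`. -/
theorem alpha_integer_and_le (h : IsClassicalWith G bNum cNum D b α β) (hb : 1 ≤ b)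
    (hD : 2 ≤ D) {L : Finset (Finset V)} (hL : IsCliqueLineSystem G L) {x y : V}
    (hxy : G.dist x y = 2)
    (hx : (#{C ∈ L | x ∈ C} : ℝ) ≤ basicNumber b D)
    (hy : (#{C ∈ L | y ∈ C} : ℝ) ≤ basicNumber b D) :
    (∃ n : ℤ, α = n) ∧ α ≤ b := by
  have hnadj : ¬ G.Adj x y := by
    rw [← SimpleGraph.dist_eq_one_iff_adj, hxy]
    norm_num
  have hne : x ≠ y := by
    rintro rfl
    simp at hxy
  set Z := G.neighborFinset x ∩ G.neighborFinset y with hZ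
  have hcardZ : (#Z : ℝ) = (b + 1) * (1 + α) := by
    rw [h.isDistanceRegularWith.card_common_of_dist_eq_two hxy, h.cNum_two_eq hD]
  have hmemZ : ∀ z, z ∈ Z ↔ G.Adj x z ∧ G.Adj y z := by simp [hZ]
  clear_value Z
  have hnotmem : ∀ C ∈ L, x ∈ C → y ∈ C → False := fun C hC h1 h2 =>
    hnadj ((hL.maximal C hC).1 h1 h2 hne)
  have hZpos : 0 < (#Z : ℝ) := by
    rw [hZ, h.isDistanceRegularWith.card_common_of_dist_eq_two hxy]
    exact_mod_cast h.cNum_pos (by omega) hD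
  have hα : 0 < 1 + α := by
    rw [hcardZ] at hZpos
    exact (pos_iff_pos_of_mul_pos hZpos).1 (by linarith)
  have hlinex : ∀ C ∈ L, x ∈ C → (C ∩ Z).Nonempty → (#(C ∩ Z) : ℝ) = 1 + α := by
    intro C hC hxC hn
    have h1 : C ∩ Z = C ∩ G.neighborFinset y := by
      ext w
      rw [mem_inter, mem_inter, hmemZ, SimpleGraph.mem_neighborFinset]
      refine ⟨fun hw => ⟨hw.1, hw.2.2⟩, fun hw => ⟨hw.1, (hL.maximal C hC).1 hxC hw.1 ?_, hw.2⟩⟩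
      rintro rfl
      exact hnadj hw.2.symm
    rw [h1] at hn ⊢
    exact h.card_delsarte_clique_inter hb hD (hL.maximal C hC).1
      (h.card_line_eq hb (by omega) hL hx hC hxC) (hnotmem C hC hxC) hn
  have hliney : ∀ C ∈ L, y ∈ C → (C ∩ Z).Nonempty → (#(C ∩ Z) : ℝ) = 1 + α := by
    intro C hC hyC hn
    have h1 : C ∩ Z = C ∩ G.neighborFinset x := by
      ext w
      rw [mem_inter, mem_inter, hmemZ, SimpleGraph.mem_neighborFinset]
      refine ⟨fun hw => ⟨hw.1, hw.2.1⟩, fun hw => ⟨hw.1, hw.2, (hL.maximal C hC).1 hyC hw.1 ?_⟩⟩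
      rintro rfl
      exact hnadj hw.2
    rw [h1] at hn ⊢
    exact h.card_delsarte_clique_inter hb hD (hL.maximal C hC).1
      (h.card_line_eq hb (by omega) hL hy hC hyC) (fun hxC => hnotmem C hC hxC hyC) hn
  obtain ⟨z, hz⟩ := card_pos.1 (by exact_mod_cast hZpos : 0 < #Z)
  obtain ⟨C₀, hC₀, hxC₀, hzC₀⟩ := hL.cover x z ((hmemZ z).1 hz).1
  have hC₀card := hlinex C₀ hC₀ hxC₀ ⟨z, mem_inter.2 ⟨hzC₀, hz⟩⟩
  refine ⟨⟨(#(C₀ ∩ Z) : ℤ) - 1, ?_⟩, ?_⟩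
  · push_cast
    linarith
  set M := {C ∈ L | y ∈ C ∧ (C ∩ Z).Nonempty} with hM
  -- The lines through y cut Z into blocks of size 1 + α, and #Z = (b + 1)(1 + α).
  have hMcard : (#M : ℝ) = b + 1 := by
    have h1 := hL.sum_neighborFinset (fun w => if w ∈ Z then 1 else 0) y
    have h2 : G.neighborFinset y ∩ Z = Z := inter_eq_right.2 (hZ ▸ inter_subset_right)
    rw [← sum_filter, filter_mem_eq_inter, h2, sum_const, nsmul_eq_mul, mul_one, hcardZ] at h1
    have h3 : ∑ C ∈ L with y ∈ C, ∑ w ∈ C.erase y, (if w ∈ Z then (1 : ℝ) else 0) =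
        ∑ C ∈ L with y ∈ C, if (C ∩ Z).Nonempty then 1 + α else 0 := by
      refine sum_congr rfl fun C hC => ?_
      rw [mem_filter] at hC
      have hyZ : y ∉ C ∩ Z := by
        rw [mem_inter, hmemZ]
        exact fun hmem => hmem.2.2.ne rfl
      rw [← sum_filter, filter_mem_eq_inter, erase_inter, erase_eq_of_notMem hyZ, sum_const,
        nsmul_eq_mul, mul_one]
      split_ifs with hn
      · exact hliney C hC.1 hC.2 hn
      · rw [not_nonempty_iff_eq_empty.1 hn]
        simp
    rw [h3, ← sum_filter, filter_filter, sum_const, nsmul_eq_mul] at h1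
    exact mul_right_cancel₀ hα.ne' h1
  choose! ℓ hℓ hyℓ hzℓ using fun w (hw : w ∈ Z) => hL.cover y w ((hmemZ w).1 hw).2
  -- Distinct points of C₀ ∩ Z are joined to y by distinct lines: a line holding two of them would
  -- be C₀, which misses y.
  have hle : #(C₀ ∩ Z) ≤ #M := by
    refine card_le_card_of_injOn ℓ (fun w hw => ?_) fun w hw w' hw' heq => ?_
    · have hw := (mem_inter.1 hw).2
      exact mem_filter.2 ⟨hℓ w hw, hyℓ w hw, ⟨w, mem_inter.2 ⟨hzℓ w hw, hw⟩⟩⟩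
    · obtain ⟨hwC, hw⟩ := mem_inter.1 hw
      obtain ⟨hwC', hw'⟩ := mem_inter.1 hw'
      by_contra hww
      have h1 := hL.unique C₀ hC₀ (ℓ w) (hℓ w hw) w w' hww hwC (hzℓ w hw) hwC'
        (heq ▸ hzℓ w' hw')
      exact hnotmem C₀ hC₀ hxC₀ (h1 ▸ hyℓ w hw)
  have : (#(C₀ ∩ Z) : ℝ) ≤ #M := by exact_mod_cast hle
  linarith

end IsClassicalWith

/-! ### Numerical conditions and conclusion -/

theorem theorem14 {V : Type*} [Finite V] (G : SimpleGraph V) (D : ℕ) (b α β : ℝ)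
    (hG : HasClassicalParameters G D b α β) (hb : 2 ≤ b) (hD : 3 ≤ D)
    (hβ : (1 / 3 : ℝ) * (8 * α * b + 8 * b + 5 * α) * basicNumber b D ≤ β) :
    HasSPLS G ⌊4 * basicNumber b D / 3⌋₊ ∧
      (∃ n : ℤ, α = (n : ℝ)) ∧ 0 ≤ α ∧ α ≤ b := by
  classical
  have := Fintype.ofFinite V
  obtain ⟨bNum, cNum, h⟩ := hG.exists_isClassicalWith
  have hα := h.alpha_nonneg hb hD hβ
  have hr := seven_le_basicNumber hb hD
  have hdr := h.isDistanceRegularWith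
  have hb0 := h.bNum_zero_eq
  have hb1 := h.bNum_one_eq (by omega)
  have hc1 := h.cNum_one_eq (by omega)
  have hc2 := h.cNum_two_eq (by omega)
  have hβpos := h.beta_pos (by linarith) (by omega)
  obtain ⟨x₀, y₀, hxy⟩ := hdr.connected.exists_dist_eq (i := 1) (by rw [h.diam_eq]; omega)
  rw [SimpleGraph.dist_eq_one_iff_adj] at hxy
  obtain ⟨lam, hlam⟩ : ∃ lam, lam + bNum 1 + cNum 1 = bNum 0 :=
    ⟨_, hdr.card_common_neighbors hxy⟩
  obtain ⟨m, hm⟩ : ∃ m, m + 1 = cNum 2 :=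
    ⟨cNum 2 - 1, Nat.sub_add_cancel (h.cNum_pos (by omega) (by omega))⟩
  set r := basicNumber b D with hrdef
  have hlamr : (lam : ℝ) = β + α * (r - 1) - 1 := by
    have h1 : ((lam + bNum 1 + cNum 1 : ℕ) : ℝ) = bNum 0 := by rw [hlam]
    push_cast at h1
    rw [hb0, hb1, hc1] at h1
    push_cast at h1
    linarith
  have hmr : (m : ℝ) = b + α + α * b := by
    have h1 : ((m + 1 : ℕ) : ℝ) = cNum 2 := by rw [hm]
    push_cast at h1
    rw [hc2] at h1
    linarith
  set s := ⌊4 * r / 3⌋₊ with hs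
  have hs1 : (s : ℝ) ≤ 4 * r / 3 := Nat.floor_le (by linarith)
  have hs2 : 4 * r / 3 < s + 1 := Nat.lt_floor_add_one _
  have hs3 : 2 ≤ s := Nat.le_floor (by push_cast; linarith)
  have hαb : 0 ≤ α * b := mul_nonneg hα (by linarith)
  have hm0 : (0 : ℝ) ≤ m := Nat.cast_nonneg m
  have hsm : (s : ℝ) * m ≤ (β + α * r) / 2 := by
    have h1 := mul_le_mul_of_nonneg_right hs1 hm0
    have h2 : 4 * r / 3 * m ≤ (β + α * r) / 2 := by
      rw [hmr]
      linarith
    linarith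
  have hcond1 : 2 * s * m ≤ lam + m := by
    have h1 : (2 * s * m : ℝ) ≤ lam + m := by
      rw [hlamr]
      linarith
    exact_mod_cast h1
  have hcond2 : 2 * bNum 0 + s * (s + 1) * m < 2 * (s + 1) * (lam + 1) := by
    have h1 : (2 * bNum 0 + s * (s + 1) * m : ℝ) < 2 * (s + 1) * (lam + 1) := by
      have h2 : 3 / 2 * β ≤ 2 * (lam + 1) - s * m := by
        have : 0 ≤ α * (r - 7) := mul_nonneg hα (by linarith)
        rw [hlamr]
        linarith
      -- The factor 4/3 in s is matched to this step: s + 1 > 4r/3 and (4/3)(3/2) = 2.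
      have h3 : 2 * (r * β) < (s + 1) * (3 / 2 * β) := by nlinarith
      have h4 : ((s : ℝ) + 1) * (3 / 2 * β) ≤ (s + 1) * (2 * (lam + 1) - s * m) :=
        mul_le_mul_of_nonneg_left h2 (by positivity)
      rw [hb0]
      linarith
    exact_mod_cast h1
  have hbd : HasCommonNeighborBounds G (bNum 0) lam m := by
    refine ⟨hdr.card_neighborFinset, fun x y hadj => ?_, fun x y hne hadj => ?_⟩
    · have := hdr.card_common_neighbors hadj
      omega
    · rw [hm]
      exact hdr.card_common_of_not_adj hne hadj
  have ha1 : (bNum 0 : ℤ) - bNum 1 - cNum 1 = lam := by omega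
  refine ⟨⟨bNum, cNum, hdr, bNum, cNum, hdr, ?_⟩, ?_⟩
  · rw [ha1, ← hm]
    exact hbd.isSPLSWith hs3 hcond1 hcond2 hxy
  set τ : ℤ := (lam : ℤ) + 2 - m * ((s : ℤ) - 1) with hτ
  set L : Finset (Finset V) := {C | C ∈ largeMaximalCliques G τ} with hLdef
  have hmemL : ∀ C, C ∈ L ↔ C ∈ largeMaximalCliques G τ := by simp [hLdef]
  have hL : IsCliqueLineSystem G L := by
    refine ⟨fun C hC => ?_, fun C hC => ((hmemL C).1 hC).1, ?_, ?_⟩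
    · have := two_le_card_of_mem_largeMaximalCliques (by omega) hcond1 ((hmemL C).1 hC)
      exact card_pos.1 (by omega)
    · intro C hC C' hC' x y hne
      exact hbd.line_unique hcond1 ((hmemL C).1 hC) ((hmemL C').1 hC') hne
    · intro x y hadj
      obtain ⟨C, hC, hmem⟩ := hbd.exists_line_of_adj hcond1 hcond2 hadj
      exact ⟨C, (hmemL C).2 hC, hmem⟩
  have hLs : ∀ x : V, (#{C ∈ L | x ∈ C} : ℝ) ≤ s := by
    intro x
    have h1 := hbd.card_lines_le (by omega) hcond1 hcond2 x
    have h2 : {C | C ∈ largeMaximalCliques G τ ∧ x ∈ C} =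
        (({C ∈ L | x ∈ C} : Finset (Finset V)) : Set (Finset V)) := by
      ext C
      simp [hmemL]
    rw [h2, Set.ncard_coe_finset] at h1
    exact_mod_cast h1
  have hLcard : ∀ C ∈ L, β / 2 + 1 ≤ (#C : ℝ) := by
    intro C hC
    have h1 : (τ : ℝ) ≤ #C := by exact_mod_cast ((hmemL C).1 hC).2
    rw [hτ] at h1
    push_cast at h1
    have h2 : 0 ≤ α * r := mul_nonneg hα (by linarith)
    rw [hlamr] at h1
    linarith
  -- Lines have at least β/2 + 1 points and each point is on at most s ≤ β/4 lines, so counting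
  -- incidences gives |L| < |V|/2.
  have hLV : 2 * #L < Fintype.card V := by
    have h1 := card_mul_le_of_forall_card_lines_le hLcard hLs
    have h2 : (s : ℝ) ≤ β / 4 := by
      have h3 : 0 ≤ α * b * r := mul_nonneg hαb (by linarith)
      have h4 : 0 ≤ α * r := mul_nonneg hα (by linarith)
      have h5 : 0 ≤ (b - 2) * r := mul_nonneg (by linarith) (by linarith)
      linarith
    have hV : (0 : ℝ) < Fintype.card V := by
      exact_mod_cast Fintype.card_pos_iff.2 ⟨x₀⟩
    have h6 : (2 * #L : ℝ) < Fintype.card V := by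
      by_contra! hcon
      have h7 := mul_le_mul_of_nonneg_left h2 hV.le
      have h8 := mul_le_mul_of_nonneg_right hcon (by linarith : 0 ≤ β / 2 + 1)
      linarith
    exact_mod_cast h6
  have hB := hL.card_vertices_on_many_lines_le (h.adjacency_form_ge (by linarith) hα)
  obtain ⟨x, y, hx, hy, hd⟩ := hdr.exists_dist_eq_of_card_lt (i := 2)
    (by rw [h.diam_eq]; omega) (lt_of_le_of_lt (Nat.mul_le_mul_left 2 hB) hLV)
  obtain ⟨hint, hle⟩ := h.alpha_integer_and_le (by linarith) (by omega) hL hd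
    (by simpa using hx) (by simpa using hy)
  exact ⟨hint, hα, hle⟩
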